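/- Let $\beta>0$ and $\kappa>0$. There is a constant $C>0$, depending only on $\beta$ and $\kappa$, such that the following holds. Let $G=(V,E)$ be an arbitrary connected undirected graph on $n=|V|<\infty$ nodes, with a distinguished root node $1\in V$ and diameter $\mathrm{Diam}(G)$. Let the signals $x^\star_v\in\mathbb{R}^d$, $v\in V$, be $(G,s,s')$-sparse, that is, $|\mathrm{Supp}(x^\star_1)|\le s$ and $|\mathrm{Supp}(x^\star_v-x^\star_w)|\le s'$ for every edge $(v,w)\in E$. Let $A_v=\frac{1}{\sqrt{N_v}}\widetilde A_v\in\mathbb{R}^{N_v\times d}$, $v\in V$, where the random matrices $\widetilde A_v$ are independent of each other and each of them has i.i.d. sub-Gaussian entries, that is, entries $X$ with $\mathbb{E}X=0$, $\mathbb{E}X^2=1$ and $\mathbb{P}(|X|\ge t)\le\beta e^{-\kappa t^2}$ for all $t\ge0$. Let $0<\epsilon<1$. If $$N_1\ \ge\ C\,\max\{s,\ n^2\,\mathrm{Diam}(G)\,s'\}\,\big(\log d+\log(1/\epsilon)\big)$$ and $$N_v\ \ge\ C\,n\,\mathrm{Diam}(G)\,s'\,\big(\log d+\log(n/\epsilon)\big)\quad\text{for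 every } v\in V\setminus\{1\},$$ then with probability greater than $1-\epsilon$ the Total Variation Basis Pursuit problem over the star graph on $V$ centred at the root, $$\min_{(x_v)_{v\in V}}\ \|x_1\|_1+\sum_{v\in V\setminus\{1\}}\|x_v-x_1\|_1\quad\text{subject to}\quad A_vx_v=A_vx^\star_v\ \text{ for all } v\in V,$$ has a unique solution, and this solution is $x_v=x^\star_v$ for all $v\in V$. -/

import Mathlib

open MeasureTheory ProbabilityTheory

/-- The `ℓ¹` norm of a vector in `ℝ^d`. -/
def l1Norm {d : ℕ} (x : Fin d → ℝ) : ℝ :=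
  ∑ j, |x j|

/-- The support of a vector in `ℝ^d`. -/
def supp {d : ℕ} (x : Fin d → ℝ) : Set (Fin d) :=
  {j | x j ≠ 0}

/-- `(G, s, s')`-sparsity of a collection of signals with respect to the root `r`: the root signal
has at most `s` nonzero entries, and the difference along every edge of `G` has at most `s'`. -/
def IsGraphSparse {V : Type*} {d : ℕ} (G : SimpleGraph V) (r : V) (s s' : ℕ)
    (x : V → Fin d → ℝ) : Prop :=
  (supp (x r)).ncard ≤ s ∧ ∀ v w, G.Adj v w → (supp (x v - x w)).ncard ≤ s'

/-- The `ℓ¹` norm of the difference of the signals at the two endpoints of an edge. -/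
def edgeL1 {V : Type*} {d : ℕ} (x : V → Fin d → ℝ) : Sym2 V → ℝ :=
  Sym2.lift ⟨fun v w => l1Norm (x v - x w), fun v w => by
    simp only [l1Norm, Pi.sub_apply]
    exact Finset.sum_congr rfl fun j _ => abs_sub_comm _ _⟩

open Classical in
/-- The objective of Total Variation Basis Pursuit over the graph `H` with root `r`:
`‖x_r‖₁ + ∑_{(v,w) ∈ E(H)} ‖x_v - x_w‖₁`, each undirected edge being counted once. -/
noncomputable def tvObjective {V : Type*} [Fintype V] {d : ℕ} (H : SimpleGraph V) (r : V)
    (x : V → Fin d → ℝ) : ℝ :=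
  l1Norm (x r) + ∑ e ∈ H.edgeFinset, edgeL1 x e

/-- The constraints of Total Variation Basis Pursuit: `A_v x_v = y_v` for every node `v`. -/
def IsTVBPFeasible {V : Type*} {N : V → ℕ} {d : ℕ}
    (A : ∀ v, Matrix (Fin (N v)) (Fin d) ℝ) (y : ∀ v, Fin (N v) → ℝ)
    (x : V → Fin d → ℝ) : Prop :=
  ∀ v, (A v).mulVec (x v) = y v

/-- `x` is a solution of the Total Variation Basis Pursuit problem over `H` with root `r`,
design matrices `A` and responses `y`. -/
def IsTVBPSolution {V : Type*} [Fintype V] {N : V → ℕ} {d : ℕ} (H : SimpleGraph V) (r : V)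
    (A : ∀ v, Matrix (Fin (N v)) (Fin d) ℝ) (y : ∀ v, Fin (N v) → ℝ)
    (x : V → Fin d → ℝ) : Prop :=
  IsTVBPFeasible A y x ∧ ∀ z, IsTVBPFeasible A y z → tvObjective H r x ≤ tvObjective H r z

/-- A family of independent sub-Gaussian random matrices with parameters `β`, `κ`: all the entries
of all the matrices are mutually independent, the entries of each matrix are identically
distributed, and every entry has mean zero, variance one and tails `P(|X| ≥ t) ≤ β exp(-κ t²)`. -/
structure IsSubGaussianFamily {V Ω : Type*} [MeasurableSpace Ω] {N : V → ℕ} {d : ℕ}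
    (β κ : ℝ) (μ : Measure Ω) (M : ∀ v, Ω → Matrix (Fin (N v)) (Fin d) ℝ) : Prop where
  indep : iIndepFun
    (fun (p : Σ v, Fin (N v) × Fin d) (ω : Ω) => M p.1 ω p.2.1 p.2.2) μ
  identDistrib : ∀ v i j i' j',
    IdentDistrib (fun ω => M v ω i j) (fun ω => M v ω i' j') μ μ
  mean_zero : ∀ v i j, ∫ ω, M v ω i j ∂μ = 0
  variance_one : ∀ v i j, ∫ ω, (M v ω i j) ^ 2 ∂μ = 1
  tail : ∀ v i j (t : ℝ), 0 ≤ t →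
    μ.real {ω | t ≤ |M v ω i j|} ≤ β * Real.exp (-κ * t ^ 2)

/-- The normalized design matrices `A_v = N_v^{-1/2} M_v` at a sample point. -/
noncomputable def normalizedDesign {V Ω : Type*} {N : V → ℕ} {d : ℕ}
    (M : ∀ v, Ω → Matrix (Fin (N v)) (Fin d) ℝ) (ω : Ω) (v : V) :
    Matrix (Fin (N v)) (Fin d) ℝ :=
  (1 / Real.sqrt (N v)) • M v ω

section SubGaussian

variable {Ω : Type*} [MeasurableSpace Ω] {μ : Measure Ω} {X : Ω → ℝ}

/-- Gaussian tails give an exponential moment of the square. -/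
lemma exp_sq_moment_of_tail [IsProbabilityMeasure μ] (hX : AEMeasurable X μ) {β κ : ℝ} (hβ : 0 ≤ β) (hκ : 0 < κ)
    (htail : ∀ t : ℝ, 0 ≤ t → μ.real {ω | t ≤ |X ω|} ≤ β * Real.exp (-κ * t ^ 2)) :
    Integrable (fun ω => Real.exp (κ / 2 * X ω ^ 2)) μ ∧
      ∫ ω, Real.exp (κ / 2 * X ω ^ 2) ∂μ ≤ 1 + β := by
  have hm : AEMeasurable (fun ω => Real.exp (κ / 2 * X ω ^ 2)) μ := by fun_prop
  have hnn : 0 ≤ᵐ[μ] fun ω => Real.exp (κ / 2 * X ω ^ 2) :=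
    ae_of_all _ fun ω => (Real.exp_pos _).le
  have hbound : ∀ u : ℝ, 1 < u →
      μ {ω | u ≤ Real.exp (κ / 2 * X ω ^ 2)} ≤ ENNReal.ofReal (β * u ^ (-2 : ℝ)) := by
    intro u hu
    have hlog : 0 < Real.log u := Real.log_pos hu
    have hsub : {ω | u ≤ Real.exp (κ / 2 * X ω ^ 2)} ⊆
        {ω | Real.sqrt (2 / κ * Real.log u) ≤ |X ω|} := by
      intro ω hω
      simp only [Set.mem_ofPred_eq] at hω ⊢
      rw [← Real.sqrt_sq_eq_abs]
      apply Real.sqrt_le_sqrt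
      have := (Real.log_le_iff_le_exp (by linarith)).2 hω
      rw [div_mul_eq_mul_div, div_le_iff₀ hκ]
      linarith
    refine (measure_mono hsub).trans ?_
    rw [← ofReal_measureReal]
    apply ENNReal.ofReal_le_ofReal
    refine (htail _ (Real.sqrt_nonneg _)).trans (le_of_eq ?_)
    rw [Real.sq_sqrt (by positivity), Real.rpow_def_of_pos (by linarith)]
    congr 2
    field_simp
  have hlint : ∫⁻ ω, ENNReal.ofReal (Real.exp (κ / 2 * X ω ^ 2)) ∂μ ≤
      ENNReal.ofReal (1 + β) := by
    rw [lintegral_eq_lintegral_meas_le μ hnn hm,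
      ← Set.Ioc_union_Ioi_eq_Ioi (zero_le_one' ℝ),
      lintegral_union measurableSet_Ioi (Set.Ioc_disjoint_Ioi le_rfl),
      ENNReal.ofReal_add zero_le_one hβ]
    refine add_le_add ?_ ?_
    · calc ∫⁻ u in Set.Ioc (0 : ℝ) 1, μ {ω | u ≤ Real.exp (κ / 2 * X ω ^ 2)}
          ≤ ∫⁻ u in Set.Ioc (0 : ℝ) 1, 1 := lintegral_mono fun u => prob_le_one
        _ = ENNReal.ofReal 1 := by simp
    · calc ∫⁻ u in Set.Ioi (1 : ℝ), μ {ω | u ≤ Real.exp (κ / 2 * X ω ^ 2)}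
          ≤ ∫⁻ u in Set.Ioi (1 : ℝ), ENNReal.ofReal (β * u ^ (-2 : ℝ)) :=
            setLIntegral_mono' measurableSet_Ioi fun u hu => hbound u hu
        _ = ENNReal.ofReal (∫ u in Set.Ioi (1 : ℝ), β * u ^ (-2 : ℝ)) := by
            rw [ofReal_integral_eq_lintegral_ofReal]
            · exact (integrableOn_Ioi_rpow_of_lt (by norm_num) zero_lt_one).const_mul β
            · refine (ae_restrict_iff' measurableSet_Ioi).2 (ae_of_all _ fun u hu => ?_)
              have : (0 : ℝ) < u := zero_lt_one.trans hu
              positivity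
        _ = ENNReal.ofReal β := by
            rw [integral_const_mul, integral_Ioi_rpow_of_lt (by norm_num) zero_lt_one]
            norm_num
  have hint : Integrable (fun ω => Real.exp (κ / 2 * X ω ^ 2)) μ := by
    refine ⟨hm.aestronglyMeasurable, ?_⟩
    rw [hasFiniteIntegral_iff_ofReal hnn]
    exact hlint.trans_lt ENNReal.ofReal_lt_top
  refine ⟨hint, ?_⟩
  rw [integral_eq_lintegral_of_nonneg_ae hnn hm.aestronglyMeasurable]
  exact ENNReal.toReal_le_of_le_ofReal (by linarith) hlint

lemma integrable_exp_mul_sq_of_le (hX : AEMeasurable X μ) {l m : ℝ} (hml : m ≤ l)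
    (hint : Integrable (fun ω => Real.exp (l * X ω ^ 2)) μ) :
    Integrable (fun ω => Real.exp (m * X ω ^ 2)) μ := by
  refine hint.mono' (by fun_prop) (ae_of_all _ fun ω => ?_)
  rw [Real.norm_eq_abs, abs_of_pos (Real.exp_pos _)]
  exact Real.exp_le_exp.2 (mul_le_mul_of_nonneg_right hml (sq_nonneg _))

variable [IsProbabilityMeasure μ]

lemma exp_sq_moment_le (hX : AEMeasurable X μ) {l m K : ℝ} (hl : 0 < l) (hm : 0 ≤ m) (hml : m ≤ l)
    (hint : Integrable (fun ω => Real.exp (l * X ω ^ 2)) μ)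
    (hK : ∫ ω, Real.exp (l * X ω ^ 2) ∂μ ≤ K) :
    ∫ ω, Real.exp (m * X ω ^ 2) ∂μ ≤ Real.exp (m * ((K - 1) / l)) := by
  have hpt : ∀ y : ℝ, Real.exp (m * y) ≤ (1 - m / l) + m / l * Real.exp (l * y) := by
    intro y
    have h1 : 0 ≤ m / l := by positivity
    have h2 : m / l ≤ 1 := (div_le_one hl).2 hml
    have := convexOn_exp.2 (Set.mem_univ 0) (Set.mem_univ (l * y)) (sub_nonneg.2 h2) h1 (by ring)
    simp only [smul_eq_mul, mul_zero, zero_add, Real.exp_zero, mul_one] at this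
    rwa [show m / l * (l * y) = m * y by field_simp] at this
  calc ∫ ω, Real.exp (m * X ω ^ 2) ∂μ
      ≤ ∫ ω, ((1 - m / l) + m / l * Real.exp (l * X ω ^ 2)) ∂μ :=
        integral_mono (integrable_exp_mul_sq_of_le hX hml hint)
          ((integrable_const _).add (hint.const_mul _)) fun ω => hpt _
    _ = (1 - m / l) + m / l * ∫ ω, Real.exp (l * X ω ^ 2) ∂μ := by
        rw [integral_add (integrable_const _) (hint.const_mul _), integral_const_mul]
        simp
    _ ≤ (1 - m / l) + m / l * K := by gcongr
    _ = m * ((K - 1) / l) + 1 := by field_simp; ring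
    _ ≤ _ := Real.add_one_le_exp _

lemma exp_le_add_exp_sq (x : ℝ) : Real.exp x ≤ x + Real.exp (x ^ 2) := by
  have hsq := Real.add_one_le_exp (x ^ 2)
  rcases le_total |x| 1 with h | h
  · have := (abs_le.1 (Real.abs_exp_sub_one_sub_id_le h)).2
    linarith
  · rcases le_abs'.1 h with h | h
    · have : Real.exp x ≤ 1 := Real.exp_le_one_iff.2 (by linarith)
      nlinarith
    · have : Real.exp x ≤ Real.exp (x ^ 2) := Real.exp_le_exp.2 (by nlinarith)
      linarith

lemma hasSubgaussianMGF_of_exp_sq (hX : AEMeasurable X μ) {l K : ℝ} (hl : 0 < l) (hK0 : 1 ≤ K)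
    (hint : Integrable (fun ω => Real.exp (l * X ω ^ 2)) μ)
    (hK : ∫ ω, Real.exp (l * X ω ^ 2) ∂μ ≤ K) (hX1 : Integrable X μ) (hX0 : ∫ ω, X ω ∂μ = 0) :
    HasSubgaussianMGF X (2 * K / l).toNNReal μ := by
  have hpt : ∀ t x : ℝ, t * x ≤ t ^ 2 / (4 * l) + l * x ^ 2 := by
    intro t x
    rw [← sub_nonneg, show t ^ 2 / (4 * l) + l * x ^ 2 - t * x = (t / 2 - l * x) ^ 2 / l by
      field_simp; ring]
    positivity
  have hptexp : ∀ t x : ℝ,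
      Real.exp (t * x) ≤ Real.exp (t ^ 2 / (4 * l)) * Real.exp (l * x ^ 2) := by
    intro t x
    rw [← Real.exp_add]
    exact Real.exp_le_exp.2 (hpt t x)
  have hi : ∀ t : ℝ, Integrable (fun ω => Real.exp (t * X ω)) μ := by
    intro t
    refine (hint.const_mul (Real.exp (t ^ 2 / (4 * l)))).mono' (by fun_prop)
      (ae_of_all _ fun ω => ?_)
    rw [Real.norm_eq_abs, abs_of_pos (Real.exp_pos _)]
    exact hptexp t _
  refine ⟨hi, fun t => ?_⟩
  rw [Real.coe_toNNReal _ (by positivity)]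
  rcases le_total (t ^ 2) l with h | h
  · have hmt := exp_sq_moment_le hX hl (sq_nonneg t) h hint hK
    have hit := integrable_exp_mul_sq_of_le hX h hint
    calc mgf X μ t ≤ ∫ ω, (t * X ω + Real.exp (t ^ 2 * X ω ^ 2)) ∂μ := by
          refine integral_mono (hi t) ((hX1.const_mul t).add hit) fun ω => ?_
          simpa only [mul_pow] using exp_le_add_exp_sq (t * X ω)
      _ = ∫ ω, Real.exp (t ^ 2 * X ω ^ 2) ∂μ := by
          rw [integral_add (hX1.const_mul t) hit, integral_const_mul, hX0]
          simp
      _ ≤ _ := hmt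
      _ ≤ _ := by
          apply Real.exp_le_exp.2
          rw [show 2 * K / l * t ^ 2 / 2 = t ^ 2 * (K / l) by ring]
          gcongr
          linarith
  · calc mgf X μ t ≤ ∫ ω, Real.exp (t ^ 2 / (4 * l)) * Real.exp (l * X ω ^ 2) ∂μ :=
          integral_mono (hi t) (hint.const_mul _) fun ω => hptexp t _
      _ ≤ Real.exp (t ^ 2 / (4 * l)) * K := by
          rw [integral_const_mul]
          gcongr
      _ ≤ Real.exp (t ^ 2 / (4 * l)) * Real.exp (K - 1) := by
          gcongr
          linarith [Real.add_one_le_exp (K - 1)]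
      _ ≤ _ := by
          rw [← Real.exp_add]
          apply Real.exp_le_exp.2
          have h1 : 1 ≤ t ^ 2 / l := (one_le_div hl).2 h
          rw [show t ^ 2 / (4 * l) = t ^ 2 / l / 4 by field_simp,
            show 2 * K / l * t ^ 2 / 2 = K * (t ^ 2 / l) by ring]
          nlinarith

lemma exp_sq_moment_of_hasSubgaussianMGF {c : NNReal} (hc : 0 < c)
    (hX : HasSubgaussianMGF X c μ) :
    Integrable (fun ω => Real.exp (1 / (4 * c) * X ω ^ 2)) μ ∧
      ∫ ω, Real.exp (1 / (4 * c) * X ω ^ 2) ∂μ ≤ 3 := by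
  have hc' : (0 : ℝ) < c := hc
  have := exp_sq_moment_of_tail (X := X) (μ := μ) hX.aemeasurable (β := 2) (κ := 1 / (2 * c))
    zero_le_two (by positivity) (fun t ht => ?_)
  · rw [show (1 : ℝ) / (2 * c) / 2 = 1 / (4 * c) by field_simp; norm_num] at this
    exact ⟨this.1, this.2.trans (by norm_num)⟩
  · have hsub : {ω | t ≤ |X ω|} ⊆ {ω | t ≤ X ω} ∪ {ω | t ≤ (-X) ω} := by
      intro ω hω
      simpa only [Set.mem_union, Set.mem_ofPred_eq, Pi.neg_apply] using le_abs.1 hω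
    refine (measureReal_mono hsub).trans ((measureReal_union_le _ _).trans ?_)
    have h1 := hX.measure_ge_le ht
    have h2 := hX.neg.measure_ge_le ht
    rw [show -(1 / (2 * (c : ℝ))) * t ^ 2 = -t ^ 2 / (2 * c) by ring]
    linarith

/-- Small-ball estimate in Laplace form for a variable with unit second moment. -/
lemma integral_exp_neg_mul_sq_le (hX : AEMeasurable X μ) {l t : ℝ} (hl : 0 < l) (ht : 0 ≤ t)
    (htl : t ≤ l ^ 2 / 6)
    (hint : Integrable (fun ω => Real.exp (l * X ω ^ 2)) μ)
    (hK : ∫ ω, Real.exp (l * X ω ^ 2) ∂μ ≤ 3) (hX2 : Integrable (fun ω => X ω ^ 2) μ)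
    (hvar : ∫ ω, X ω ^ 2 ∂μ = 1) :
    ∫ ω, Real.exp (-t * X ω ^ 2) ∂μ ≤ Real.exp (-t / 2) := by
  have hq : ∀ y : ℝ, 0 ≤ y → y ^ 2 / 2 ≤ Real.exp y := fun y hy => by
    have := Real.quadratic_le_exp_of_nonneg hy
    linarith
  have hneg : ∀ y : ℝ, 0 ≤ y → Real.exp (-y) ≤ 1 - y + y ^ 2 / 2 := by
    intro y hy
    have h := Real.quadratic_le_exp_of_nonneg hy
    rw [Real.exp_neg, inv_le_comm₀ (Real.exp_pos _) (by nlinarith [sq_nonneg (y - 1)])]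
    refine le_trans ?_ h
    rw [inv_le_iff_one_le_mul₀ (by nlinarith [sq_nonneg (y - 1)])]
    nlinarith [sq_nonneg (y ^ 2)]
  have hpt : ∀ y : ℝ, 0 ≤ y →
      Real.exp (-t * y) ≤ 1 - t * y + t ^ 2 / l ^ 2 * Real.exp (l * y) := by
    intro y hy
    have h1 := hneg (t * y) (by positivity)
    have h2 := hq (l * y) (by positivity)
    have h3 : (t * y) ^ 2 / 2 = t ^ 2 / l ^ 2 * ((l * y) ^ 2 / 2) := by field_simp
    have h4 : t ^ 2 / l ^ 2 * ((l * y) ^ 2 / 2) ≤ t ^ 2 / l ^ 2 * Real.exp (l * y) := by gcongr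
    rw [neg_mul]
    linarith
  calc ∫ ω, Real.exp (-t * X ω ^ 2) ∂μ
      ≤ ∫ ω, (1 - t * X ω ^ 2 + t ^ 2 / l ^ 2 * Real.exp (l * X ω ^ 2)) ∂μ :=
        integral_mono (integrable_exp_mul_sq_of_le hX (by linarith) hint)
          (((integrable_const _).sub (hX2.const_mul t)).add (hint.const_mul _))
          fun ω => hpt _ (sq_nonneg _)
    _ = 1 - t + t ^ 2 / l ^ 2 * ∫ ω, Real.exp (l * X ω ^ 2) ∂μ := by
        have hi : Integrable (fun ω => 1 - t * X ω ^ 2) μ :=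
          (integrable_const _).sub (hX2.const_mul t)
        rw [integral_add hi (hint.const_mul _),
          integral_sub (integrable_const _) (hX2.const_mul t), integral_const_mul,
          integral_const_mul, hvar]
        simp
    _ ≤ 1 - t + t ^ 2 / l ^ 2 * 3 := by gcongr
    _ ≤ -t / 2 + 1 := by
        have : t ^ 2 / l ^ 2 * 3 ≤ t / 2 := by
          rw [div_mul_eq_mul_div, div_le_iff₀ (by positivity)]
          nlinarith
        linarith
    _ ≤ _ := Real.add_one_le_exp _

end SubGaussian

section Independence

lemma iIndepFun_curry {Ω ι : Type*} [MeasurableSpace Ω] {P : Measure Ω} {κ : ι → Type*}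
    {X : (i : ι) → κ i → Ω → ℝ} (mX : ∀ i j, Measurable (X i j))
    (h : iIndepFun (fun (p : (i : ι) × κ i) ω => X p.1 p.2 ω) P) :
    iIndepFun (fun i ω => (X i · ω)) P := by
  have := h.isProbabilityMeasure
  have : ∀ i j, IsProbabilityMeasure (P.map (X i j)) :=
    fun i j => Measure.isProbabilityMeasure_map (mX i j).aemeasurable
  have : ∀ i, IsProbabilityMeasure (P.map (fun ω => (X i · ω))) :=
    fun i => Measure.isProbabilityMeasure_map (Measurable.aemeasurable (by fun_prop))
  have hrow : ∀ i, iIndepFun (X i) P := fun i =>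
    h.precomp (g := fun j => ⟨i, j⟩) (fun a b hab => by simpa using hab)
  have hc : (MeasurableEquiv.piCurry fun (i : ι) (_ : κ i) => ℝ) ∘ (fun ω p => X p.1 p.2 ω) =
      fun ω i j => X i j ω := by
    ext; simp [Sigma.curry]
  rw [iIndepFun_iff_map_fun_eq_infinitePi_map (by fun_prop), ← hc,
    ← Measure.map_map (by fun_prop) (by fun_prop),
    (iIndepFun_iff_map_fun_eq_infinitePi_map (by fun_prop)).1 h,
    Measure.infinitePi_map_piCurry (fun i j => P.map (X i j))]
  congrm Measure.infinitePi fun i => ?_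
  rw [(iIndepFun_iff_map_fun_eq_infinitePi_map (by fun_prop)).1 (hrow i)]

/-- Linear combinations along the rows of an array of independent variables are independent. -/
lemma iIndepFun_row_sum {Ω ι : Type*} [MeasurableSpace Ω] [Countable ι] {P : Measure Ω} {d : ℕ}
    {X : ι → Fin d → Ω → ℝ} (mX : ∀ i j, AEMeasurable (X i j) P)
    (h : iIndepFun (fun (p : (_ : ι) × Fin d) ω => X p.1 p.2 ω) P) (z : Fin d → ℝ) :
    iIndepFun (fun i ω => ∑ j, X i j ω * z j) P := by
  have hY : iIndepFun (fun (p : (_ : ι) × Fin d) ω => (mX p.1 p.2).mk _ ω) P :=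
    h.congr fun p => (mX p.1 p.2).ae_eq_mk
  have hcur := iIndepFun_curry (X := fun i j => (mX i j).mk _)
    (fun i j => (mX i j).measurable_mk) hY
  refine (hcur.comp (fun _ y => ∑ j, y j * z j) (fun _ => by fun_prop)).congr fun i => ?_
  have : ∀ᵐ ω ∂P, ∀ j, X i j ω = (mX i j).mk _ ω :=
    ae_all_iff.2 fun j => (mX i j).ae_eq_mk
  filter_upwards [this] with ω hω
  simp [hω]

end Independence

section Concentration

variable {Ω ι : Type*} [MeasurableSpace Ω] {μ : Measure Ω} [Fintype ι]

/-- Chernoff bound for a sum of independent variables with bounded exponential moments. -/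
lemma measure_sum_ge_le_of_exp_moment {Y : ι → Ω → ℝ} (hind : iIndepFun Y μ)
    (hm : ∀ i, AEMeasurable (Y i) μ) (hint : ∀ i, Integrable (fun ω => Real.exp (Y i ω)) μ)
    {a : ι → ℝ} (ha : ∀ i, ∫ ω, Real.exp (Y i ω) ∂μ ≤ Real.exp (a i)) (τ : ℝ) :
    μ.real {ω | τ ≤ ∑ i, Y i ω} ≤ Real.exp (∑ i, a i - τ) := by
  have := hind.isProbabilityMeasure
  have hprod := hind.mgf_sum₀ (t := 1) hm Finset.univ
  have hpos : ∀ i, 0 < mgf (Y i) μ 1 := fun i => mgf_pos (by simpa only [one_mul] using hint i)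
  have hintsum : Integrable (fun ω => Real.exp (1 * (∑ i, Y i) ω)) μ := by
    apply Integrable.of_integral_ne_zero
    change mgf (∑ i, Y i) μ 1 ≠ 0
    rw [hprod]
    exact (Finset.prod_pos fun i _ => hpos i).ne'
  calc μ.real {ω | τ ≤ ∑ i, Y i ω} = μ.real {ω | τ ≤ (∑ i, Y i) ω} := by
        simp only [Finset.sum_apply]
    _ ≤ _ := measure_ge_le_exp_mul_mgf τ zero_le_one hintsum
    _ ≤ Real.exp (-1 * τ) * ∏ i, Real.exp (a i) := by
        rw [hprod]
        gcongr with i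
        · exact fun i _ => mgf_nonneg
        · simpa only [mgf, one_mul] using ha i
    _ = _ := by
        rw [← Real.exp_sum, ← Real.exp_add]
        congr 1; ring

variable {X : ι → Ω → ℝ} {l : ℝ} {c : ι → ℝ}

/-- Upper tail of a weighted sum of squares. -/
lemma measure_weighted_sq_ge_le (hX : ∀ i, AEMeasurable (X i) μ)
    (hind : iIndepFun X μ) (hl : 0 < l)
    (hint : ∀ i, Integrable (fun ω => Real.exp (l * X i ω ^ 2)) μ)
    (hK : ∀ i, ∫ ω, Real.exp (l * X i ω ^ 2) ∂μ ≤ 3) (hc : ∀ i, 0 ≤ c i)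
    (hcl : ∀ i, c i ≤ l) (τ : ℝ) :
    μ.real {ω | τ ≤ ∑ i, c i * X i ω ^ 2} ≤ Real.exp (2 / l * ∑ i, c i - τ) := by
  have := hind.isProbabilityMeasure
  have hb : ∀ i, ∫ ω, Real.exp (c i * X i ω ^ 2) ∂μ ≤ Real.exp (2 / l * c i) := fun i => by
    have := exp_sq_moment_le (hX i) hl (hc i) (hcl i) (hint i) (hK i)
    rwa [show (3 : ℝ) - 1 = 2 by norm_num, mul_comm] at this
  rw [Finset.mul_sum]
  exact measure_sum_ge_le_of_exp_moment
    (hind.comp (fun i x => c i * x ^ 2) fun i => by fun_prop) (fun i => by fun_prop)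
    (fun i => integrable_exp_mul_sq_of_le (hX i) (hcl i) (hint i)) hb τ

/-- Lower tail of a weighted sum of squares. -/
lemma measure_weighted_sq_le_le (hX : ∀ i, AEMeasurable (X i) μ)
    (hind : iIndepFun X μ) (hl : 0 < l)
    (hint : ∀ i, Integrable (fun ω => Real.exp (l * X i ω ^ 2)) μ)
    (hK : ∀ i, ∫ ω, Real.exp (l * X i ω ^ 2) ∂μ ≤ 3)
    (hX2 : ∀ i, Integrable (fun ω => X i ω ^ 2) μ) (hvar : ∀ i, ∫ ω, X i ω ^ 2 ∂μ = 1)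
    (hc : ∀ i, 0 ≤ c i) (hcl : ∀ i, c i ≤ l ^ 2 / 6) (τ : ℝ) :
    μ.real {ω | ∑ i, c i * X i ω ^ 2 ≤ τ} ≤ Real.exp (τ - (∑ i, c i) / 2) := by
  have := hind.isProbabilityMeasure
  have hb : ∀ i, ∫ ω, Real.exp (-c i * X i ω ^ 2) ∂μ ≤ Real.exp (-c i / 2) := fun i =>
    integral_exp_neg_mul_sq_le (hX i) hl (hc i) (hcl i) (hint i) (hK i) (hX2 i) (hvar i)
  have h := measure_sum_ge_le_of_exp_moment
    (hind.comp (fun i x => -c i * x ^ 2) fun i => by fun_prop) (fun i => by fun_prop)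
    (fun i => integrable_exp_mul_sq_of_le (hX i) (by linarith [hc i]) (hint i)) hb (-τ)
  convert! h using 2
  · ext ω
    simp [Finset.sum_neg_distrib]
  · rw [← Finset.sum_div, Finset.sum_neg_distrib]
    ring

end Concentration

section RandomArray

/-- An array of independent, centred, unit-variance variables with a common sub-Gaussian
constant. -/
structure IsSubGaussianArray {Ω ι : Type*} [MeasurableSpace Ω] {d : ℕ} (c : NNReal)
    (μ : Measure Ω) (a : ι → Fin d → Ω → ℝ) : Prop where
  indep : iIndepFun (fun (p : (_ : ι) × Fin d) ω => a p.1 p.2 ω) μ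
  subgaussian : ∀ i j, HasSubgaussianMGF (a i j) c μ
  mean_zero : ∀ i j, ∫ ω, a i j ω ∂μ = 0
  variance_one : ∀ i j, ∫ ω, a i j ω ^ 2 ∂μ = 1

lemma exists_normalization {d : ℕ} {z : Fin d → ℝ} (hz : z ≠ 0) : ∃ r : ℝ, 0 < r ∧ r ^ 2 = ∑ j, z j ^ 2 ∧
    ∑ j, (z j / r) ^ 2 = 1 := by
  have hpos : 0 < ∑ j, z j ^ 2 := by
    obtain ⟨j, hj⟩ := Function.ne_iff.1 hz
    exact Finset.sum_pos' (fun j _ => sq_nonneg _) ⟨j, Finset.mem_univ _, by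
      have : z j ≠ 0 := hj
      positivity⟩
  refine ⟨Real.sqrt (∑ j, z j ^ 2), Real.sqrt_pos.2 hpos, Real.sq_sqrt hpos.le, ?_⟩
  simp only [div_pow, Real.sq_sqrt hpos.le]
  rw [← Finset.sum_div, div_self hpos.ne']

namespace IsSubGaussianArray

variable {Ω ι : Type*} [MeasurableSpace Ω] {d : ℕ} {c : NNReal} {μ : Measure Ω}
  {a : ι → Fin d → Ω → ℝ} {z : Fin d → ℝ}

lemma hasSubgaussianMGF_row (h : IsSubGaussianArray c μ a) (hz : ∑ j, z j ^ 2 = 1) (i : ι) :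
    HasSubgaussianMGF (fun ω => ∑ j, a i j ω * z j) c μ := by
  have hrow : iIndepFun (a i) μ :=
    h.indep.precomp (g := fun j => ⟨i, j⟩) (fun x y hxy => by simpa using hxy)
  have hs := HasSubgaussianMGF.sum_of_iIndepFun (s := Finset.univ)
    (hrow.comp (fun j x => z j * x) fun j => by fun_prop)
    (fun j _ => (h.subgaussian i j).const_mul (z j))
  have hs' : HasSubgaussianMGF (fun ω => ∑ j, ((fun x => z j * x) ∘ a i j) ω) c μ := by
    convert! hs using 1
    apply NNReal.eq
    rw [NNReal.coe_sum]
    calc (c : ℝ) = (∑ j, z j ^ 2) * c := by rw [hz, one_mul]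
      _ = _ := Finset.sum_mul _ _ _
  refine hs'.congr (ae_of_all _ fun ω => ?_)
  simp [mul_comm]

lemma integral_row_sq (h : IsSubGaussianArray c μ a) (hz : ∑ j, z j ^ 2 = 1) (i : ι) :
    ∫ ω, (∑ j, a i j ω * z j) ^ 2 ∂μ = 1 := by
  have := h.indep.isProbabilityMeasure
  have hrow : iIndepFun (a i) μ :=
    h.indep.precomp (g := fun j => ⟨i, j⟩) (fun x y hxy => by simpa using hxy)
  have hL : ∀ j, MemLp (a i j) 2 μ := fun j => by
    exact_mod_cast (h.subgaussian i j).memLp 2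
  have hL' : ∀ j, MemLp (fun ω => a i j ω * z j) 2 μ := fun j => (hL j).mul_const (z j)
  have hvarj : ∀ j, variance (fun ω => a i j ω * z j) μ = z j ^ 2 := fun j => by
    rw [variance_of_integral_eq_zero (hL' j).aemeasurable
      (by rw [integral_mul_const, h.mean_zero, zero_mul])]
    simp only [mul_pow]
    rw [integral_mul_const, h.variance_one, one_mul]
  have hmean : ∫ ω, (∑ j, fun ω => a i j ω * z j) ω ∂μ = 0 := by
    simp only [Finset.sum_apply]
    rw [integral_finsetSum _ fun j _ => (hL' j).integrable one_le_two]
    simp only [integral_mul_const, h.mean_zero, zero_mul, Finset.sum_const_zero]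
  have hv := IndepFun.variance_sum (s := Finset.univ) (fun j _ => hL' j)
    (fun j _ k _ hjk => ((hrow.comp (fun j x => x * z j) fun j => by fun_prop).indepFun hjk))
  rw [variance_of_integral_eq_zero (by
    exact Finset.aemeasurable_sum _ fun j _ => (hL' j).aemeasurable) hmean] at hv
  simpa only [Finset.sum_apply, hvarj, hz] using hv

lemma row_moments (h : IsSubGaussianArray c μ a) (hc : 0 < c) (hz : ∑ j, z j ^ 2 = 1) (i : ι) :
    AEMeasurable (fun ω => ∑ j, a i j ω * z j) μ ∧
    Integrable (fun ω => Real.exp (1 / (4 * c) * (∑ j, a i j ω * z j) ^ 2)) μ ∧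
    ∫ ω, Real.exp (1 / (4 * c) * (∑ j, a i j ω * z j) ^ 2) ∂μ ≤ 3 ∧
    Integrable (fun ω => (∑ j, a i j ω * z j) ^ 2) μ ∧
    ∫ ω, (∑ j, a i j ω * z j) ^ 2 ∂μ = 1 := by
  have := h.indep.isProbabilityMeasure
  have hs := h.hasSubgaussianMGF_row hz i
  have he := exp_sq_moment_of_hasSubgaussianMGF hc hs
  refine ⟨hs.aemeasurable, he.1, he.2, ?_, h.integral_row_sq hz i⟩
  exact MemLp.integrable_sq (by exact_mod_cast hs.memLp 2)

lemma _root_.sum_weighted_row_sq {Ω ι : Type*} [Fintype ι] {d : ℕ} {a : ι → Fin d → Ω → ℝ}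
    {z : Fin d → ℝ} {w : ι → ℝ} (r : ℝ) (ω : Ω) :
    ∑ i, w i * (∑ j, a i j ω * (z j / r)) ^ 2 = (∑ i, w i * (∑ j, a i j ω * z j) ^ 2) / r ^ 2 := by
  rw [Finset.sum_div]
  refine Finset.sum_congr rfl fun i _ => ?_
  simp only [← mul_div_assoc]
  rw [← Finset.sum_div, div_pow, mul_div_assoc]

variable [Fintype ι] {w : ι → ℝ}

lemma measure_weighted_gt_le (h : IsSubGaussianArray c μ a) (hc : 0 < c) (hw : ∀ i, 0 ≤ w i)
    (hwl : ∀ i, w i ≤ 1 / (4 * c)) (z : Fin d → ℝ) (τ : ℝ) :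
    μ.real {ω | τ * ∑ j, z j ^ 2 < ∑ i, w i * (∑ j, a i j ω * z j) ^ 2} ≤
      Real.exp (8 * c * ∑ i, w i - τ) := by
  rcases eq_or_ne z 0 with rfl | hz
  · simpa using (Real.exp_pos _).le
  have := h.indep.isProbabilityMeasure
  have hc' : (0 : ℝ) < c := hc
  obtain ⟨r, hr, hr2, hz1⟩ := exists_normalization hz
  have hm := fun i => h.row_moments hc hz1 i
  have hb := measure_weighted_sq_ge_le (l := 1 / (4 * c)) (fun i => (hm i).1)
    (iIndepFun_row_sum (fun i j => (h.subgaussian i j).aemeasurable) h.indep fun j => z j / r)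
    (by positivity) (fun i => (hm i).2.1) (fun i => (hm i).2.2.1) hw hwl τ
  rw [show (2 : ℝ) / (1 / (4 * c)) = 8 * c by field_simp; norm_num] at hb
  refine (measureReal_mono fun ω hω => ?_).trans hb
  simp only [Set.mem_ofPred_eq] at hω ⊢
  rw [sum_weighted_row_sq, le_div_iff₀ (by positivity), hr2]
  exact hω.le

lemma measure_weighted_lt_le (h : IsSubGaussianArray c μ a) (hc : 0 < c) (hw : ∀ i, 0 ≤ w i)
    (hwl : ∀ i, w i ≤ (1 / (4 * c)) ^ 2 / 6) (z : Fin d → ℝ) (τ : ℝ) :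
    μ.real {ω | ∑ i, w i * (∑ j, a i j ω * z j) ^ 2 < τ * ∑ j, z j ^ 2} ≤
      Real.exp (τ - (∑ i, w i) / 2) := by
  rcases eq_or_ne z 0 with rfl | hz
  · simpa using (Real.exp_pos _).le
  have := h.indep.isProbabilityMeasure
  have hc' : (0 : ℝ) < c := hc
  obtain ⟨r, hr, hr2, hz1⟩ := exists_normalization hz
  have hm := fun i => h.row_moments hc hz1 i
  have hb := measure_weighted_sq_le_le (l := 1 / (4 * c)) (fun i => (hm i).1)
    (iIndepFun_row_sum (fun i j => (h.subgaussian i j).aemeasurable) h.indep fun j => z j / r)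
    (by positivity) (fun i => (hm i).2.1) (fun i => (hm i).2.2.1) (fun i => (hm i).2.2.2.1)
    (fun i => (hm i).2.2.2.2) hw hwl τ
  refine (measureReal_mono fun ω hω => ?_).trans hb
  simp only [Set.mem_ofPred_eq] at hω ⊢
  rw [sum_weighted_row_sq, div_le_iff₀ (by positivity), hr2]
  exact hω.le

end IsSubGaussianArray
end RandomArray

section Maurey

variable {d : ℕ}

/-- The sum of the signed basis vectors listed by `f`. -/
def signedSum {k : ℕ} (f : Fin k → Fin d × Bool) : Fin d → ℝ :=
  ∑ i, Pi.single (f i).1 (if (f i).2 then 1 else -1)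

/-- The quadratic form of a square matrix. -/
def quadForm (S : Matrix (Fin d) (Fin d) ℝ) (v : Fin d → ℝ) : ℝ :=
  dotProduct v (S.mulVec v)

lemma quadForm_smul (S : Matrix (Fin d) (Fin d) ℝ) (t : ℝ) (v : Fin d → ℝ) :
    quadForm S (t • v) = t ^ 2 * quadForm S v := by
  simp only [quadForm, Matrix.mulVec_smul, smul_dotProduct, dotProduct_smul, smul_eq_mul]
  ring

lemma quadForm_single (S : Matrix (Fin d) (Fin d) ℝ) (j : Fin d) (t : ℝ) :
    quadForm S (Pi.single j t) = t ^ 2 * S j j := by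
  simp [quadForm, Matrix.mulVec_single]
  ring

/-- Averaging a quadratic form over a shifted finite distribution. -/
lemma sum_mul_quadForm_add (S : Matrix (Fin d) (Fin d) ℝ) {ι : Type*} [Fintype ι] {p : ι → ℝ}
    (hp : ∑ i, p i = 1) (Y : ι → Fin d → ℝ) (b : Fin d → ℝ) :
    ∑ i, p i * quadForm S (b + Y i) = quadForm S (b + ∑ i, p i • Y i) +
      (∑ i, p i * quadForm S (Y i) - quadForm S (∑ i, p i • Y i)) := by
  have hexp : ∀ y : Fin d → ℝ, quadForm S (b + y) =
      quadForm S b + dotProduct b (S.mulVec y) + dotProduct y (S.mulVec b) + quadForm S y := by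
    intro y
    simp only [quadForm, Matrix.mulVec_add, dotProduct_add, add_dotProduct]
    ring
  have h1 : dotProduct b (S.mulVec (∑ i, p i • Y i)) = ∑ i, p i * dotProduct b (S.mulVec (Y i)) := by
    rw [Matrix.mulVec_sum, dotProduct_sum]
    simp only [Matrix.mulVec_smul, dotProduct_smul, smul_eq_mul]
  have h2 : dotProduct (∑ i, p i • Y i) (S.mulVec b) = ∑ i, p i * dotProduct (Y i) (S.mulVec b) := by
    rw [sum_dotProduct]
    simp only [smul_dotProduct, smul_eq_mul]
  rw [hexp, h1, h2]
  simp only [hexp, mul_add, Finset.sum_add_distrib]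
  rw [← Finset.sum_mul, hp]
  ring

lemma signedSum_cons {k : ℕ} (x : Fin d × Bool) (f : Fin k → Fin d × Bool) :
    signedSum (Fin.cons x f : Fin (k + 1) → Fin d × Bool) =
      Pi.single x.1 (if x.2 then 1 else -1) + signedSum f := by
  simp [signedSum, Fin.sum_univ_succ]

/-- Empirical method of Maurey: a quadratic form that is nonnegative on sums of `k` signed basis
vectors is almost nonnegative on vectors of small `ℓ¹` norm. -/
lemma quadForm_lower_of_signedSum {S : Matrix (Fin d) (Fin d) ℝ} {k : ℕ} {B : ℝ}
    (hS : ∀ f : Fin (k + 1) → Fin d × Bool, 0 ≤ quadForm S (signedSum f))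
    (hB : ∀ j, S j j ≤ B) (h : Fin d → ℝ) :
    0 ≤ k * quadForm S h + B * l1Norm h ^ 2 := by
  rcases eq_or_ne h 0 with rfl | hne
  · simp [quadForm, l1Norm]
  have hT : 0 < l1Norm h := by
    obtain ⟨j, hj⟩ := Function.ne_iff.1 hne
    exact Finset.sum_pos' (fun j _ => abs_nonneg _) ⟨j, Finset.mem_univ _, abs_pos.2 hj⟩
  set T := l1Norm h with hTdef
  set p : Fin d → ℝ := fun j => |h j| / T
  set σ : Fin d → Bool := fun j => decide (0 ≤ h j)
  set Y : Fin d → Fin d → ℝ := fun j => T • Pi.single j (if σ j then 1 else -1)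
  have hp0 : ∀ j, 0 ≤ p j := fun j => by positivity
  have hp : ∑ j, p j = 1 := by
    rw [← Finset.sum_div]
    exact div_self hT.ne'
  have hmean : ∑ j, p j • Y j = h := by
    ext i
    rw [Finset.sum_apply, Finset.sum_eq_single i]
    · simp only [p, Y, σ, Pi.smul_apply, Pi.single_eq_same, smul_eq_mul, decide_eq_true_eq]
      split_ifs with hi
      · rw [abs_of_nonneg hi]; field_simp
      · rw [abs_of_neg (not_le.1 hi)]; field_simp
    · intro j _ hji
      simp [Y, Pi.single_eq_of_ne hji.symm]
    · simp
  set E := ∑ j, p j * quadForm S (Y j)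
  have hE : E ≤ B * T ^ 2 := by
    calc E ≤ ∑ j, p j * (B * T ^ 2) := by
          refine Finset.sum_le_sum fun j _ => mul_le_mul_of_nonneg_left ?_ (hp0 j)
          simp only [Y, quadForm_smul, quadForm_single]
          have : (if σ j = true then (1 : ℝ) else -1) ^ 2 = 1 := by split_ifs <;> norm_num
          rw [this, one_mul, mul_comm]
          exact mul_le_mul_of_nonneg_right (hB j) (sq_nonneg _)
      _ = B * T ^ 2 := by rw [← Finset.sum_mul, hp, one_mul]
  have key : ∀ (m : ℕ) (b : Fin d → ℝ),
      (∀ f : Fin m → Fin d × Bool, 0 ≤ quadForm S (b + T • signedSum f)) →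
      0 ≤ quadForm S (b + (m : ℝ) • h) + m * (E - quadForm S h) := by
    intro m
    induction m with
    | zero =>
      intro b hb
      simpa [signedSum] using hb Fin.elim0
    | succ m ih =>
      intro b hb
      have hstep : ∀ j, 0 ≤ quadForm S ((b + (m : ℝ) • h) + Y j) + m * (E - quadForm S h) := by
        intro j
        have := ih (b + Y j) fun f => by
          have := hb (Fin.cons (j, σ j) f)
          rwa [signedSum_cons, smul_add, ← add_assoc] at this
        rwa [add_right_comm] at this
      have havg := Finset.sum_nonneg fun j (_ : j ∈ Finset.univ) => mul_nonneg (hp0 j) (hstep j)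
      simp only [mul_add, Finset.sum_add_distrib] at havg
      rw [sum_mul_quadForm_add S hp, hmean, ← Finset.sum_mul, hp] at havg
      rw [Nat.cast_succ, add_smul, one_smul, ← add_assoc]
      linarith
  have hfin := key (k + 1) 0 fun f => by
    rw [zero_add, quadForm_smul]
    exact mul_nonneg (sq_nonneg _) (hS f)
  rw [zero_add, quadForm_smul] at hfin
  push_cast at hfin
  have hk : (0 : ℝ) < k + 1 := by positivity
  have : 0 ≤ (k + 1 : ℝ) * (k * quadForm S h + E) := by linarith
  have := nonneg_of_mul_nonneg_right this hk
  linarith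

/-- Energy of a vector under a weighted family of row vectors. -/
def rowEnergy {ι : Type*} [Fintype ι] (w : ι → ℝ) (a : ι → Fin d → ℝ) (z : Fin d → ℝ) : ℝ :=
  ∑ i, w i * (∑ j, a i j * z j) ^ 2

lemma quadForm_rowEnergy {ι : Type*} [Fintype ι] (w : ι → ℝ) (a : ι → Fin d → ℝ) (s t : ℝ)
    (z : Fin d → ℝ) :
    quadForm (Matrix.of fun j k => s * (∑ i, w i * (a i j * a i k)) + t * if j = k then 1 else 0) z =
      s * rowEnergy w a z + t * ∑ j, z j ^ 2 := by
  simp only [quadForm, dotProduct, Matrix.mulVec, Matrix.of_apply, rowEnergy, add_mul,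
    Finset.sum_add_distrib, mul_add]
  congr 1
  · simp only [Finset.mul_sum, Finset.sum_mul, sq]
    rw [Finset.sum_congr rfl fun j _ => Finset.sum_comm, Finset.sum_comm]
    refine Finset.sum_congr rfl fun i _ => Finset.sum_congr rfl fun j _ =>
      Finset.sum_congr rfl fun k _ => ?_
    ring
  · rw [Finset.mul_sum]
    refine Finset.sum_congr rfl fun j _ => ?_
    simp
    ring

lemma rowEnergy_single {ι : Type*} [Fintype ι] (w : ι → ℝ) (a : ι → Fin d → ℝ) (j : Fin d) :
    rowEnergy w a (Pi.single j 1) = ∑ i, w i * (a i j * a i j) := by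
  simp [rowEnergy, Pi.single_apply, sq]

/-- Restricted lower bound for the energy. -/
lemma rowEnergy_lower {ι : Type*} [Fintype ι] {w : ι → ℝ} {a : ι → Fin d → ℝ} {α B : ℝ} {k : ℕ}
    (hα : 0 ≤ α) (hS : ∀ f : Fin (k + 1) → Fin d × Bool,
      α * ∑ j, signedSum f j ^ 2 ≤ rowEnergy w a (signedSum f))
    (hB : ∀ j, rowEnergy w a (Pi.single j 1) ≤ B) (h : Fin d → ℝ) :
    α * k * ∑ j, h j ^ 2 ≤ k * rowEnergy w a h + B * l1Norm h ^ 2 := by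
  have := quadForm_lower_of_signedSum (S := Matrix.of fun j k =>
    1 * (∑ i, w i * (a i j * a i k)) + (-α) * if j = k then 1 else 0) (k := k) (B := B)
    (fun f => by rw [quadForm_rowEnergy]; linarith [hS f])
    (fun j => by
      have := hB j
      rw [rowEnergy_single] at this
      simp only [Matrix.of_apply, if_true]
      linarith) h
  rw [quadForm_rowEnergy] at this
  linarith

/-- Restricted upper bound for the energy. -/
lemma rowEnergy_upper {ι : Type*} [Fintype ι] {w : ι → ℝ} {a : ι → Fin d → ℝ} {B : ℝ} {k : ℕ}
    (hw : ∀ i, 0 ≤ w i) (hS : ∀ f : Fin (k + 1) → Fin d × Bool,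
      rowEnergy w a (signedSum f) ≤ B * ∑ j, signedSum f j ^ 2) (h : Fin d → ℝ) :
    k * rowEnergy w a h ≤ B * (k * ∑ j, h j ^ 2 + l1Norm h ^ 2) := by
  have := quadForm_lower_of_signedSum (S := Matrix.of fun j k =>
    (-1) * (∑ i, w i * (a i j * a i k)) + B * if j = k then 1 else 0) (k := k) (B := B)
    (fun f => by rw [quadForm_rowEnergy]; linarith [hS f])
    (fun j => by
      have : 0 ≤ ∑ i, w i * (a i j * a i j) :=
        Finset.sum_nonneg fun i _ => mul_nonneg (hw i) (mul_self_nonneg _)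
      simp only [Matrix.of_apply, if_true]
      linarith) h
  rw [quadForm_rowEnergy] at this
  linarith

end Maurey

section Cone

variable {d : ℕ}

lemma l1Norm_nonneg (u : Fin d → ℝ) : 0 ≤ l1Norm u := Finset.sum_nonneg fun _ _ => abs_nonneg _

lemma eq_zero_of_l1Norm_eq_zero {u : Fin d → ℝ} (h : l1Norm u = 0) : u = 0 := by
  ext j
  simpa using (Finset.sum_eq_zero_iff_of_nonneg fun j _ => abs_nonneg (u j)).1 h j
    (Finset.mem_univ _)

open Classical in
/-- The `ℓ¹` mass of `u` on the support of `y`. -/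
noncomputable def l1On (y u : Fin d → ℝ) : ℝ := ∑ j with y j ≠ 0, |u j|

lemma l1Norm_add_ge (y u : Fin d → ℝ) : l1Norm y + l1Norm u - 2 * l1On y u ≤ l1Norm (y + u) := by
  classical
  simp only [l1Norm, l1On, Finset.sum_filter, Finset.mul_sum, ← Finset.sum_add_distrib,
    ← Finset.sum_sub_distrib]
  refine Finset.sum_le_sum fun j _ => ?_
  by_cases hj : y j = 0
  · simp [hj]
  · simp only [ne_eq, hj, not_false_eq_true, if_true, Pi.add_apply]
    have := abs_sub (y j + u j) (u j)
    rw [add_sub_cancel_right] at this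
    linarith

lemma l1On_sq_le (y u : Fin d → ℝ) : l1On y u ^ 2 ≤ (supp y).ncard * ∑ j, u j ^ 2 := by
  classical
  have hcard : (supp y).ncard = (Finset.univ.filter fun j => y j ≠ 0).card := by
    rw [← Set.ncard_coe_finset]
    congr 1
    ext j
    simp [supp]
  rw [hcard]
  refine sq_sum_le_card_mul_sum_sq.trans ?_
  gcongr
  simp only [sq_abs]
  exact Finset.sum_le_sum_of_subset_of_nonneg (Finset.subset_univ _) fun _ _ _ => sq_nonneg _

lemma l1On_zero_left (u : Fin d → ℝ) : l1On 0 u = 0 := by simp [l1On]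

end Cone

section Graph

variable {V : Type*} {d : ℕ}

lemma supp_eq_empty_iff {y : Fin d → ℝ} : supp y = ∅ ↔ y = 0 := by
  simp [supp, Set.eq_empty_iff_forall_notMem, funext_iff]

lemma eq_zero_of_ncard_supp {y : Fin d → ℝ} (h : (supp y).ncard ≤ 0) : y = 0 :=
  supp_eq_empty_iff.1 ((Set.ncard_eq_zero (Set.toFinite _)).1 (Nat.le_zero.1 h))

lemma ncard_supp_add_le (y u : Fin d → ℝ) :
    (supp (y + u)).ncard ≤ (supp y).ncard + (supp u).ncard := by
  refine (Set.ncard_le_ncard ?_ (Set.toFinite _)).trans (Set.ncard_union_le _ _)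
  intro j hj
  by_contra hcon
  simp only [supp, Set.mem_union, Set.mem_ofPred_eq, not_or, not_not, Pi.add_apply] at hj hcon
  exact hj (by rw [hcon.1, hcon.2, add_zero])

lemma ncard_supp_sub_le_of_walk {G : SimpleGraph V} {s' : ℕ} {x : V → Fin d → ℝ}
    (hx : ∀ v w, G.Adj v w → (supp (x v - x w)).ncard ≤ s') {v w : V} (p : G.Walk v w) :
    (supp (x v - x w)).ncard ≤ p.length * s' := by
  induction p with
  | nil => simp [supp]
  | @cons u v w h p ih =>
    rw [← sub_add_sub_cancel (x u) (x v) (x w), SimpleGraph.Walk.length_cons, add_mul, one_mul,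
      add_comm (p.length * s')]
    exact (ncard_supp_add_le _ _).trans (add_le_add (hx _ _ h) ih)

lemma IsGraphSparse.ncard_supp_sub_le [Fintype V] {G : SimpleGraph V} {r : V} {s s' : ℕ}
    {x : V → Fin d → ℝ} (hx : IsGraphSparse G r s s' x) (hG : G.Connected) (v w : V) :
    (supp (x v - x w)).ncard ≤ G.diam * s' := by
  have := hG.nonempty
  obtain ⟨p, hp⟩ := hG.exists_walk_length_eq_dist v w
  refine (ncard_supp_sub_le_of_walk hx.2 p).trans (Nat.mul_le_mul_right _ ?_)
  rw [hp]
  exact SimpleGraph.dist_le_diam (SimpleGraph.connected_iff_ediam_ne_top.1 hG)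

open Classical in
lemma tvObjective_starGraph [Fintype V] (r : V) (x : V → Fin d → ℝ) :
    tvObjective (SimpleGraph.starGraph r) r x =
      l1Norm (x r) + ∑ v ∈ Finset.univ.erase r, l1Norm (x v - x r) := by
  have himg : (SimpleGraph.starGraph r).edgeFinset =
      (Finset.univ.erase r).image fun v => s(v, r) := by
    ext e
    induction e using Sym2.ind with
    | _ v w =>
      simp only [SimpleGraph.mem_edgeFinset, SimpleGraph.mem_edgeSet, SimpleGraph.starGraph_adj,
        Finset.mem_image, Finset.mem_erase, Finset.mem_univ, and_true, Sym2.eq_iff]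
      constructor
      · rintro ⟨hne, rfl | rfl⟩
        · exact ⟨w, hne.symm, Or.inr ⟨rfl, rfl⟩⟩
        · exact ⟨v, hne, Or.inl ⟨rfl, rfl⟩⟩
      · rintro ⟨u, hu, ⟨rfl, rfl⟩ | ⟨rfl, rfl⟩⟩
        · exact ⟨hu, Or.inr rfl⟩
        · exact ⟨hu.symm, Or.inl rfl⟩
  unfold tvObjective
  congr 1
  convert! Finset.sum_image (s := Finset.univ.erase r) (g := fun v => s(v, r))
    (f := edgeL1 x) ?_ using 2
  · convert himg
  · intro v _ w _ hvw
    rcases Sym2.eq_iff.1 hvw with ⟨h, -⟩ | ⟨h, h'⟩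
    · exact h
    · exact h.trans h'

open Classical in
/-- The error of a competitor with no larger objective is concentrated on the supports. -/
lemma cone_of_tvObjective_le [Fintype V] {r : V} {x z : V → Fin d → ℝ}
    (h : tvObjective (SimpleGraph.starGraph r) r z ≤ tvObjective (SimpleGraph.starGraph r) r x) :
    l1Norm (z r - x r) + ∑ v ∈ Finset.univ.erase r, l1Norm ((z v - x v) - (z r - x r)) ≤
      2 * (l1On (x r) (z r - x r) +
        ∑ v ∈ Finset.univ.erase r, l1On (x v - x r) ((z v - x v) - (z r - x r))) := by
  rw [tvObjective_starGraph, tvObjective_starGraph] at h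
  have h1 := l1Norm_add_ge (x r) (z r - x r)
  rw [add_sub_cancel] at h1
  have h2 : ∀ v, l1Norm (x v - x r) + l1Norm ((z v - x v) - (z r - x r)) -
      2 * l1On (x v - x r) ((z v - x v) - (z r - x r)) ≤ l1Norm (z v - z r) := fun v => by
    have := l1Norm_add_ge (x v - x r) ((z v - x v) - (z r - x r))
    rwa [show x v - x r + (z v - x v - (z r - x r)) = z v - z r by abel] at this
  have h3 := Finset.sum_le_sum fun v (_ : v ∈ Finset.univ.erase r) => h2 v
  rw [Finset.sum_sub_distrib, Finset.sum_add_distrib, ← Finset.mul_sum] at h3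
  linarith

end Graph

section Deterministic

variable {V : Type*} [Fintype V] {N : V → ℕ} {d : ℕ}

open Classical in
/-- The normalized energy `‖A_v z‖²` of the measurements at the node `v`. -/
noncomputable def nodeEnergy (M : ∀ v, Matrix (Fin (N v)) (Fin d) ℝ) (v : V) (z : Fin d → ℝ) : ℝ :=
  rowEnergy (fun p : (v : V) × Fin (N v) => if p.1 = v then 1 / (N v : ℝ) else 0)
    (fun p j => M p.1 p.2 j) z

open Classical in
/-- The total energy of the measurements at the nodes other than `r`. -/
noncomputable def outerEnergy (M : ∀ v, Matrix (Fin (N v)) (Fin d) ℝ) (r : V) (z : Fin d → ℝ) :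
    ℝ :=
  rowEnergy (fun p : (v : V) × Fin (N v) => if p.1 = r then 0 else 1 / (N p.1 : ℝ))
    (fun p j => M p.1 p.2 j) z

variable {M : ∀ v, Matrix (Fin (N v)) (Fin d) ℝ}

lemma nodeEnergy_eq (v : V) (z : Fin d → ℝ) :
    nodeEnergy M v z = 1 / (N v : ℝ) * ∑ i, (∑ j, M v i j * z j) ^ 2 := by
  classical
  simp only [nodeEnergy, rowEnergy, Fintype.sum_sigma]
  rw [Finset.sum_eq_single v]
  · simp [Finset.mul_sum]
  · intro u _ hu
    simp [hu]
  · simp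

lemma nodeEnergy_nonneg (v : V) (z : Fin d → ℝ) : 0 ≤ nodeEnergy M v z := by
  rw [nodeEnergy_eq]
  positivity

open Classical in
lemma outerEnergy_eq (r : V) (z : Fin d → ℝ) :
    outerEnergy M r z = ∑ v ∈ Finset.univ.erase r, nodeEnergy M v z := by
  simp only [outerEnergy, nodeEnergy_eq, rowEnergy, Fintype.sum_sigma]
  rw [← Finset.add_sum_erase _ _ (Finset.mem_univ r)]
  simp only [if_true, zero_mul, Finset.sum_const_zero, zero_add]
  refine Finset.sum_congr rfl fun v hv => ?_
  simp [(Finset.mem_erase.1 hv).1, Finset.mul_sum]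

lemma row_eq_of_feasible {V : Type*} {N : V → ℕ} {M : ∀ v, Matrix (Fin (N v)) (Fin d) ℝ} {v : V} {y y' : Fin d → ℝ}
    (h : ((1 / Real.sqrt (N v)) • M v).mulVec y = ((1 / Real.sqrt (N v)) • M v).mulVec y')
    (i : Fin (N v)) : ∑ j, M v i j * (y - y') j = 0 := by
  have hN : 0 < N v := i.pos
  have hpos : (0 : ℝ) < 1 / Real.sqrt (N v) := by positivity
  rw [Matrix.smul_mulVec, Matrix.smul_mulVec] at h
  have := congrFun (smul_right_injective _ hpos.ne' h) i
  simp only [Matrix.mulVec, dotProduct] at this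
  simp only [Pi.sub_apply, mul_sub, Finset.sum_sub_distrib, this, sub_self]

/-- The measurement matrices act well on sums of at most `k + 1` signed basis vectors. -/
structure NodeRegular (M : ∀ v, Matrix (Fin (N v)) (Fin d) ℝ) (B : ℝ) (k : ℕ) (v : V) : Prop where
  lower : ∀ f : Fin (k + 1) → Fin d × Bool,
    1 / 4 * ∑ j, signedSum f j ^ 2 ≤ nodeEnergy M v (signedSum f)
  column : ∀ j, nodeEnergy M v (Pi.single j 1) ≤ B

lemma NodeRegular.energy_lower {B : ℝ} {k : ℕ} {v : V} (h : NodeRegular M B k v)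
    (u : Fin d → ℝ) :
    1 / 4 * k * ∑ j, u j ^ 2 ≤ k * nodeEnergy M v u + B * l1Norm u ^ 2 :=
  rowEnergy_lower (by norm_num) h.lower h.column u

lemma outerEnergy_upper {B : ℝ} {k : ℕ} {r : V}
    (h : ∀ f : Fin (k + 1) → Fin d × Bool,
      outerEnergy M r (signedSum f) ≤ B * ∑ j, signedSum f j ^ 2) (u : Fin d → ℝ) :
    k * outerEnergy M r u ≤ B * (k * ∑ j, u j ^ 2 + l1Norm u ^ 2) :=
  rowEnergy_upper (fun p => by split_ifs <;> positivity) h u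

/-- Uniqueness of the ground truth among feasible competitors. -/
def Recovers (r : V) (M : ∀ v, Matrix (Fin (N v)) (Fin d) ℝ) (x : V → Fin d → ℝ) : Prop :=
  ∀ z : V → Fin d → ℝ, (∀ v i, ∑ j, M v i j * (z v - x v) j = 0) →
    tvObjective (SimpleGraph.starGraph r) r z ≤ tvObjective (SimpleGraph.starGraph r) r x → z = x

open Classical in
lemma eq_of_cone_bounds {r : V} {x z : V → Fin d → ℝ}
    (h : tvObjective (SimpleGraph.starGraph r) r z ≤ tvObjective (SimpleGraph.starGraph r) r x)
    {g : V → ℝ} (hp : l1On (x r) (z r - x r) ≤ 1 / 5 * l1Norm (z r - x r))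
    (hpv : ∀ v ∈ Finset.univ.erase r, l1On (x v - x r) ((z v - x v) - (z r - x r)) ≤
      g v + 1 / 5 * l1Norm ((z v - x v) - (z r - x r)))
    (hg : ∑ v ∈ Finset.univ.erase r, g v ≤ 1 / 5 * l1Norm (z r - x r)) : z = x := by
  have hc := cone_of_tvObjective_le h
  have hs := Finset.sum_le_sum hpv
  rw [Finset.sum_add_distrib, ← Finset.mul_sum] at hs
  have h0 := l1Norm_nonneg (z r - x r)
  have h1 : ∀ v ∈ Finset.univ.erase r, 0 ≤ l1Norm ((z v - x v) - (z r - x r)) :=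
    fun v _ => l1Norm_nonneg _
  have h2 := Finset.sum_nonneg h1
  have hr : z r - x r = 0 := eq_zero_of_l1Norm_eq_zero (by linarith)
  have hv := (Finset.sum_eq_zero_iff_of_nonneg h1).1 (by linarith)
  ext1 v
  by_cases hvr : v = r
  · rw [hvr]
    exact sub_eq_zero.1 hr
  · have := eq_zero_of_l1Norm_eq_zero (hv v (by simp [hvr]))
    rw [hr, sub_zero] at this
    exact sub_eq_zero.1 this

lemma recovers_of_forall_eq_zero (r : V) {x : V → Fin d → ℝ} (hx : ∀ v, x v = 0) :
    Recovers r M x := by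
  intro z _ hobj
  refine eq_of_cone_bounds (g := 0) hobj ?_ (fun v _ => ?_) ?_
  · rw [hx, l1On_zero_left]
    have := l1Norm_nonneg (z r - 0)
    positivity
  · rw [hx, hx, sub_zero 0, l1On_zero_left]
    have := l1Norm_nonneg (z v - 0 - (z r - 0))
    simp only [Pi.zero_apply, zero_add]
    positivity
  · have := l1Norm_nonneg (z r - x r)
    simp only [Pi.zero_apply, Finset.sum_const_zero]
    positivity

lemma root_bounds {r : V} {x z : V → Fin d → ℝ} {s m K : ℕ} {B : ℝ}
    (hK : 100 * B ≤ K) (hK0 : 0 < K)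
    (hm : 0 < m) (hsm : s ≤ m) (hs : (supp (x r)).ncard ≤ s) (hreg : NodeRegular M B (K * m) r)
    (hz : ∀ v i, ∑ j, M v i j * (z v - x v) j = 0) :
    1 / 4 * (K * m) * ∑ j, (z r - x r) j ^ 2 ≤ B * l1Norm (z r - x r) ^ 2 ∧
    l1On (x r) (z r - x r) ≤ 1 / 5 * l1Norm (z r - x r) := by
  have hlow := hreg.energy_lower (z r - x r)
  have hE : nodeEnergy M r (z r - x r) = 0 := by
    rw [nodeEnergy_eq]
    simp only [hz r, ne_eq, OfNat.ofNat_ne_zero, not_false_eq_true, zero_pow,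
      Finset.sum_const_zero, mul_zero]
  rw [hE, mul_zero, zero_add] at hlow
  push_cast at hlow
  refine ⟨hlow, ?_⟩
  have hsq := l1On_sq_le (x r) (z r - x r)
  set H := ∑ j, (z r - x r) j ^ 2
  have hH : 0 ≤ H := Finset.sum_nonneg fun j _ => sq_nonneg _
  have hm' : (0 : ℝ) < m := by exact_mod_cast hm
  have hK' : (0 : ℝ) < K := by exact_mod_cast hK0
  have hsm' : ((supp (x r)).ncard : ℝ) ≤ m := by exact_mod_cast hs.trans hsm
  apply le_of_sq_le_sq _ (by have := l1Norm_nonneg (z r - x r); positivity)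
  have h1 : l1On (x r) (z r - x r) ^ 2 ≤ m * H := hsq.trans (by gcongr)
  have h2 : K * (m * H) ≤ K * (1 / 25 * l1Norm (z r - x r) ^ 2) := by
    nlinarith [sq_nonneg (l1Norm (z r - x r))]
  have := le_of_mul_le_mul_left h2 hK'
  linarith

lemma recovers_of_no_differences {r : V} {x : V → Fin d → ℝ} {s m K : ℕ} {B : ℝ}
    (hK : 100 * B ≤ K) (hK0 : 0 < K) (hm : 0 < m) (hsm : s ≤ m) (hs : (supp (x r)).ncard ≤ s)
    (hx : ∀ v, x v - x r = 0) (hreg : NodeRegular M B (K * m) r) : Recovers r M x := by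
  intro z hz hobj
  refine eq_of_cone_bounds (g := 0) hobj (root_bounds hK hK0 hm hsm hs hreg hz).2
    (fun v _ => ?_) ?_
  · rw [hx, l1On_zero_left]
    have := l1Norm_nonneg (z v - x v - (z r - x r))
    simp only [Pi.zero_apply, zero_add]
    positivity
  · have := l1Norm_nonneg (z r - x r)
    simp only [Pi.zero_apply, Finset.sum_const_zero]
    positivity

open Classical in
lemma recovers_of_regular {r : V} {x : V → Fin d → ℝ} {s t m K : ℕ} {B : ℝ} (hB : 0 ≤ B)
    (hK : 100 * B * (4 * B + 1) ≤ K) (hK0 : 0 < K) (ht : 0 < t) (hsm : s ≤ m)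
    (htm : Fintype.card V ^ 2 * t ≤ m) (hs : (supp (x r)).ncard ≤ s)
    (hx : ∀ v, (supp (x v - x r)).ncard ≤ t) (hreg : NodeRegular M B (K * m) r)
    (hregv : ∀ v, v ≠ r → NodeRegular M B (K * t) v)
    (hout : ∀ f : Fin (K * (Fintype.card V ^ 2 * t) + 1) → Fin d × Bool,
      outerEnergy M r (signedSum f) ≤ B * Fintype.card V * ∑ j, signedSum f j ^ 2) :
    Recovers r M x := by
  intro z hz hobj
  set n := Fintype.card V with hn
  have hn0 : 0 < n := Fintype.card_pos_iff.2 ⟨r⟩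
  have hnt : 0 < n ^ 2 * t := by positivity
  have hK1 : 100 * B ≤ K := le_trans (by nlinarith) hK
  obtain ⟨hH, hp⟩ := root_bounds hK1 hK0 (hnt.trans_le htm) hsm hs hreg hz
  set h := z r - x r with hh
  have hT := outerEnergy_upper hout h
  have hn' : (0 : ℝ) < n := by exact_mod_cast hn0
  have ht' : (0 : ℝ) < t := by exact_mod_cast ht
  have hK' : (0 : ℝ) < K := by exact_mod_cast hK0
  have hl := l1Norm_nonneg h
  have hQ : ∀ v, 0 ≤ nodeEnergy M v h := fun v => nodeEnergy_nonneg v h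
  refine eq_of_cone_bounds (g := fun v => Real.sqrt (4 * t * nodeEnergy M v h)) hobj hp
    (fun v hv => ?_) ?_
  · have hvr : v ≠ r := (Finset.mem_erase.1 hv).1
    set w := z v - x v - h with hw
    have hlow := (hregv v hvr).energy_lower w
    have hQe : nodeEnergy M v w = nodeEnergy M v h := by
      rw [nodeEnergy_eq, nodeEnergy_eq]
      congr 1
      refine Finset.sum_congr rfl fun i _ => ?_
      have h1 : ∑ j, M v i j * w j = - ∑ j, M v i j * h j := by
        have := hz v i
        rw [show z v - x v = w + h by rw [hw]; abel] at this
        simp only [Pi.add_apply, mul_add, Finset.sum_add_distrib] at this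
        linarith
      rw [h1, neg_sq]
    rw [hQe] at hlow
    push_cast at hlow
    have hlw := l1Norm_nonneg w
    have hsq := l1On_sq_le (x v - x r) w
    set W := ∑ j, w j ^ 2
    have hW : 0 ≤ W := Finset.sum_nonneg fun j _ => sq_nonneg _
    have hcard : ((supp (x v - x r)).ncard : ℝ) ≤ t := by exact_mod_cast hx v
    have h1 : l1On (x v - x r) w ^ 2 ≤ t * W := hsq.trans (by gcongr)
    have h2 : K * (t * W) ≤ K * (4 * t * nodeEnergy M v h + 1 / 25 * l1Norm w ^ 2) := by
      nlinarith [sq_nonneg (l1Norm w)]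
    have h3 := le_of_mul_le_mul_left h2 hK'
    apply le_of_sq_le_sq _ (by positivity)
    have h4 : 0 ≤ 4 * t * nodeEnergy M v h := by have := hQ v; positivity
    have h5 := Real.sq_sqrt h4
    have h6 := Real.sqrt_nonneg (4 * t * nodeEnergy M v h)
    nlinarith [mul_nonneg h6 hlw]
  · rw [outerEnergy_eq] at hT
    set T := ∑ v ∈ Finset.univ.erase r, nodeEnergy M v h
    set H := ∑ j, h j ^ 2
    have hHn : 0 ≤ H := Finset.sum_nonneg fun j _ => sq_nonneg _
    have htm' : (n : ℝ) ^ 2 * t ≤ m := by exact_mod_cast htm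
    apply le_of_sq_le_sq _ (by positivity)
    have h1 : (∑ v ∈ Finset.univ.erase r, Real.sqrt (4 * t * nodeEnergy M v h)) ^ 2 ≤
        n * (4 * t * T) := by
      refine sq_sum_le_card_mul_sum_sq.trans ?_
      have hc : ((Finset.univ.erase r).card : ℝ) ≤ n := by
        exact_mod_cast Finset.card_le_univ _
      have he : ∑ v ∈ Finset.univ.erase r, Real.sqrt (4 * t * nodeEnergy M v h) ^ 2 =
          4 * t * T := by
        rw [Finset.mul_sum]
        refine Finset.sum_congr rfl fun v _ => Real.sq_sqrt ?_
        have := hQ v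
        positivity
      rw [he]
      have : 0 ≤ T := Finset.sum_nonneg fun v _ => hQ v
      gcongr
    push_cast at hT
    have h2 : K * (n ^ 2 * t) * H ≤ 4 * B * l1Norm h ^ 2 := by
      have : K * (n ^ 2 * t) * H ≤ K * m * H := by gcongr
      linarith
    have h3 : n * (K * (n * (4 * t * T))) ≤ n * (K * (1 / 25 * l1Norm h ^ 2)) := by
      have e1 : n * (K * (n * (4 * t * T))) = 4 * (K * (n ^ 2 * t) * T) := by ring
      have e2 : 4 * (K * (n ^ 2 * t) * T) ≤
          4 * (B * n * (4 * B * l1Norm h ^ 2 + l1Norm h ^ 2)) := by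
        refine mul_le_mul_of_nonneg_left (hT.trans ?_) (by norm_num)
        gcongr
      have e3 : 4 * (B * n * (4 * B * l1Norm h ^ 2 + l1Norm h ^ 2)) =
          n * (1 / 25 * (100 * B * (4 * B + 1)) * l1Norm h ^ 2) := by ring
      have e4 : n * (1 / 25 * (100 * B * (4 * B + 1)) * l1Norm h ^ 2) ≤
          n * (1 / 25 * K * l1Norm h ^ 2) := by gcongr
      linarith
    have h4 := le_of_mul_le_mul_left (le_of_mul_le_mul_left h3 hn') hK'
    linarith

lemma isTVBPSolution_iff_of_recovers {Ω : Type*} [MeasurableSpace Ω]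
    {X : ∀ v, Ω → Matrix (Fin (N v)) (Fin d) ℝ} {ω : Ω} {r : V} {x : V → Fin d → ℝ}
    (h : Recovers r (fun v => X v ω) x) (z : V → Fin d → ℝ) :
    IsTVBPSolution (SimpleGraph.starGraph r) r (normalizedDesign X ω)
      (fun v => (normalizedDesign X ω v).mulVec (x v)) z ↔ z = x := by
  have hx : IsTVBPFeasible (normalizedDesign X ω)
      (fun v => (normalizedDesign X ω v).mulVec (x v)) x := fun v => rfl
  have key : ∀ y, IsTVBPFeasible (normalizedDesign X ω)
      (fun v => (normalizedDesign X ω v).mulVec (x v)) y →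
      tvObjective (SimpleGraph.starGraph r) r y ≤ tvObjective (SimpleGraph.starGraph r) r x →
      y = x := fun y hy hobj =>
    h y (fun v i => row_eq_of_feasible (M := fun v => X v ω) (hy v) i) hobj
  constructor
  · rintro ⟨hf, hmin⟩
    exact key z hf (hmin x hx)
  · rintro rfl
    refine ⟨hx, fun y hy => ?_⟩
    by_contra hcon
    rw [not_le] at hcon
    rw [key y hy hcon.le] at hcon
    exact lt_irrefl _ hcon

end Deterministic

section Family

/-- The sub-Gaussian constant of entries with parameters `β`, `κ`. -/
noncomputable def subGaussianConst (β κ : ℝ) : NNReal := (2 * (1 + max β 1) / (κ / 2)).toNNReal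

/-- The exponential rate of the energy concentration. -/
noncomputable def energyRate (c : NNReal) : ℝ :=
  min (1 / (4 * (c : ℝ))) ((1 / (4 * (c : ℝ))) ^ 2 / 6) / 4

lemma subGaussianConst_pos (β : ℝ) {κ : ℝ} (hκ : 0 < κ) : 0 < subGaussianConst β κ := by
  have : 0 < max β 1 := lt_max_of_lt_right one_pos
  exact Real.toNNReal_pos.2 (by positivity)

lemma energyRate_pos {c : NNReal} (hc : 0 < c) : 0 < energyRate c := by
  have : (0 : ℝ) < c := hc
  unfold energyRate
  have : 0 < min (1 / (4 * (c : ℝ))) ((1 / (4 * (c : ℝ))) ^ 2 / 6) :=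
    lt_min (by positivity) (by positivity)
  positivity

variable {V Ω : Type*} [MeasurableSpace Ω] {N : V → ℕ} {d : ℕ} {β κ : ℝ} {μ : Measure Ω}
  {M : ∀ v, Ω → Matrix (Fin (N v)) (Fin d) ℝ}

lemma IsSubGaussianFamily.isSubGaussianArray (h : IsSubGaussianFamily β κ μ M) (hκ : 0 < κ) :
    IsSubGaussianArray (subGaussianConst β κ) μ
      (fun (p : (v : V) × Fin (N v)) j ω => M p.1 ω p.2 j) where
  indep := h.indep.precomp
    (g := fun p : (_ : (v : V) × Fin (N v)) × Fin d => ⟨p.1.1, (p.1.2, p.2)⟩) (by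
      rintro ⟨⟨v, i⟩, j⟩ ⟨⟨v', i'⟩, j'⟩ hp
      simp only [Sigma.mk.injEq] at hp
      obtain ⟨rfl, hp⟩ := hp
      simp only [heq_eq_eq, Prod.mk.injEq] at hp
      obtain ⟨rfl, rfl⟩ := hp
      rfl)
  subgaussian := fun p j => by
    have := h.indep.isProbabilityMeasure
    have hm : AEMeasurable (fun ω => M p.1 ω p.2 j) μ :=
      (h.identDistrib p.1 p.2 j p.2 j).aemeasurable_fst
    have h1 : (1 : ℝ) ≤ max β 1 := le_max_right _ _
    have he := exp_sq_moment_of_tail hm (β := max β 1) (by linarith) hκ fun t ht =>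
      (h.tail p.1 p.2 j t ht).trans
        (mul_le_mul_of_nonneg_right (le_max_left _ _) (Real.exp_pos _).le)
    have hi2 : Integrable (fun ω => M p.1 ω p.2 j ^ 2) μ := by
      apply Integrable.of_integral_ne_zero
      rw [h.variance_one]
      exact one_ne_zero
    have hi : Integrable (fun ω => M p.1 ω p.2 j) μ :=
      ((memLp_two_iff_integrable_sq hm.aestronglyMeasurable).2 hi2).integrable one_le_two
    exact hasSubgaussianMGF_of_exp_sq hm (by positivity) (by linarith) he.1 he.2 hi
      (h.mean_zero _ _ _)
  mean_zero := fun p j => h.mean_zero _ _ _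
  variance_one := fun p j => h.variance_one _ _ _

variable [Fintype V] {c : NNReal}

lemma rowEnergy_const_mul {ι : Type*} [Fintype ι] (t : ℝ) (w : ι → ℝ) (a : ι → Fin d → ℝ)
    (z : Fin d → ℝ) : rowEnergy (fun i => t * w i) a z = t * rowEnergy w a z := by
  simp only [rowEnergy, Finset.mul_sum, mul_assoc]

open Classical in
lemma sum_node_weight (v : V) :
    ∑ p : (v : V) × Fin (N v), (if p.1 = v then 1 / (N v : ℝ) else 0) =
      (N v : ℝ) * (1 / (N v : ℝ)) := by
  rw [Fintype.sum_sigma, Finset.sum_eq_single v]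
  · simp
  · intro u _ hu
    simp [hu]
  · simp

lemma measure_nodeEnergy_lt_le
    (h : IsSubGaussianArray c μ (fun (p : (v : V) × Fin (N v)) j ω => M p.1 ω p.2 j))
    (hc : 0 < c) (v : V) (z : Fin d → ℝ) :
    μ.real {ω | nodeEnergy (fun v => M v ω) v z < 1 / 4 * ∑ j, z j ^ 2} ≤
      Real.exp (-(energyRate c * N v)) := by
  classical
  have := h.indep.isProbabilityMeasure
  have hr := energyRate_pos hc
  rcases Nat.eq_zero_or_pos (N v) with hN | hN
  · rw [hN]
    simp
  have hN' : (0 : ℝ) < N v := by exact_mod_cast hN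
  have hb := h.measure_weighted_lt_le hc
    (w := fun p => (4 * energyRate c * N v) * if p.1 = v then 1 / (N v : ℝ) else 0)
    (fun p => by split_ifs <;> positivity)
    (fun p => by
      split_ifs
      · rw [mul_one_div, mul_div_assoc, div_self hN'.ne', mul_one]
        unfold energyRate
        rw [mul_div_cancel₀ _ (by norm_num)]
        exact min_le_right _ _
      · rw [mul_zero]
        positivity) z (energyRate c * N v)
  rw [← Finset.mul_sum, sum_node_weight, mul_one_div, div_self hN'.ne'] at hb
  refine (measureReal_mono fun ω hω => ?_).trans (hb.trans (Real.exp_le_exp.2 (by linarith)))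
  simp only [Set.mem_ofPred_eq] at hω ⊢
  have he := rowEnergy_const_mul (4 * energyRate c * N v)
    (fun p : (v : V) × Fin (N v) => if p.1 = v then 1 / (N v : ℝ) else 0)
    (fun p j => M p.1 ω p.2 j) z
  change rowEnergy
      (fun p : (v : V) × Fin (N v) => (4 * energyRate c * N v) * if p.1 = v then 1 / (N v : ℝ) else 0)
    (fun p j => M p.1 ω p.2 j) z < _
  rw [he]
  have := mul_lt_mul_of_pos_left hω (show 0 < 4 * energyRate c * N v by positivity)
  refine this.trans_eq ?_
  ring

lemma measure_nodeEnergy_gt_le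
    (h : IsSubGaussianArray c μ (fun (p : (v : V) × Fin (N v)) j ω => M p.1 ω p.2 j))
    (hc : 0 < c) (v : V) (z : Fin d → ℝ) :
    μ.real {ω | (8 * c + 1) * ∑ j, z j ^ 2 < nodeEnergy (fun v => M v ω) v z} ≤
      Real.exp (-(energyRate c * N v)) := by
  classical
  have := h.indep.isProbabilityMeasure
  have hr := energyRate_pos hc
  rcases Nat.eq_zero_or_pos (N v) with hN | hN
  · rw [hN]
    simp
  have hN' : (0 : ℝ) < N v := by exact_mod_cast hN
  have hb := h.measure_weighted_gt_le hc
    (w := fun p => (4 * energyRate c * N v) * if p.1 = v then 1 / (N v : ℝ) else 0)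
    (fun p => by split_ifs <;> positivity)
    (fun p => by
      split_ifs
      · rw [mul_one_div, mul_div_assoc, div_self hN'.ne', mul_one]
        unfold energyRate
        rw [mul_div_cancel₀ _ (by norm_num)]
        exact min_le_left _ _
      · rw [mul_zero]
        positivity) z (4 * energyRate c * N v * (8 * c + 1))
  rw [← Finset.mul_sum, sum_node_weight, mul_one_div, div_self hN'.ne'] at hb
  refine (measureReal_mono fun ω hω => ?_).trans (hb.trans (Real.exp_le_exp.2 ?_))
  · simp only [Set.mem_ofPred_eq] at hω ⊢
    have he := rowEnergy_const_mul (4 * energyRate c * N v)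
      (fun p : (v : V) × Fin (N v) => if p.1 = v then 1 / (N v : ℝ) else 0)
      (fun p j => M p.1 ω p.2 j) z
    change _ < rowEnergy
      (fun p : (v : V) × Fin (N v) => (4 * energyRate c * N v) * if p.1 = v then 1 / (N v : ℝ) else 0)
      (fun p j => M p.1 ω p.2 j) z
    rw [he]
    have := mul_lt_mul_of_pos_left hω (show 0 < 4 * energyRate c * N v by positivity)
    refine Eq.trans_lt ?_ this
    ring
  · have : 0 < energyRate c * N v := by positivity
    nlinarith

lemma measure_outerEnergy_gt_le
    (h : IsSubGaussianArray c μ (fun (p : (v : V) × Fin (N v)) j ω => M p.1 ω p.2 j))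
    (hc : 0 < c) (r : V) {N₀ : ℝ} (hN₀ : 0 < N₀) (hN : ∀ v, v ≠ r → N₀ ≤ N v) (z : Fin d → ℝ) :
    μ.real {ω | (8 * c + 1) * Fintype.card V * ∑ j, z j ^ 2 <
        outerEnergy (fun v => M v ω) r z} ≤
      Real.exp (-(energyRate c * (Fintype.card V * N₀))) := by
  classical
  have := h.indep.isProbabilityMeasure
  have hr := energyRate_pos hc
  have hb := h.measure_weighted_gt_le hc
    (w := fun p => (4 * energyRate c * N₀) * if p.1 = r then 0 else 1 / (N p.1 : ℝ))
    (fun p => by split_ifs <;> positivity)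
    (fun p => by
      split_ifs with hp
      · rw [mul_zero]
        positivity
      · have h1 := hN p.1 hp
        have h2 : N₀ * (1 / (N p.1 : ℝ)) ≤ 1 := by
          rw [mul_one_div]
          exact (div_le_one (hN₀.trans_le h1)).2 h1
        calc 4 * energyRate c * N₀ * (1 / (N p.1 : ℝ))
            = 4 * energyRate c * (N₀ * (1 / (N p.1 : ℝ))) := by ring
          _ ≤ 4 * energyRate c * 1 := by gcongr
          _ ≤ _ := by
            unfold energyRate
            rw [mul_one, mul_div_cancel₀ _ (by norm_num)]
            exact min_le_left _ _) z
    (4 * energyRate c * N₀ * ((8 * c + 1) * Fintype.card V))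
  have hsum : ∑ p : (v : V) × Fin (N v), (if p.1 = r then 0 else 1 / (N p.1 : ℝ)) ≤
      Fintype.card V := by
    rw [Fintype.sum_sigma]
    calc _ ≤ ∑ _v : V, (1 : ℝ) := by
          refine Finset.sum_le_sum fun v _ => ?_
          by_cases hv : v = r
          · simp [hv]
          · have h1 := hN₀.trans_le (hN v hv)
            simp [hv, h1.ne']
      _ = _ := by simp
  rw [← Finset.mul_sum] at hb
  refine (measureReal_mono fun ω hω => ?_).trans (hb.trans (Real.exp_le_exp.2 ?_))
  · simp only [Set.mem_ofPred_eq] at hω ⊢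
    have he := rowEnergy_const_mul (4 * energyRate c * N₀)
      (fun p : (v : V) × Fin (N v) => if p.1 = r then 0 else 1 / (N p.1 : ℝ))
      (fun p j => M p.1 ω p.2 j) z
    change _ < rowEnergy
      (fun p : (v : V) × Fin (N v) => (4 * energyRate c * N₀) * if p.1 = r then 0 else 1 / (N p.1 : ℝ))
      (fun p j => M p.1 ω p.2 j) z
    rw [he]
    have := mul_lt_mul_of_pos_left hω (show 0 < 4 * energyRate c * N₀ by positivity)
    refine Eq.trans_lt ?_ this
    ring
  · have h1 : 8 * (c : ℝ) * (4 * energyRate c * N₀ *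
        ∑ p : (v : V) × Fin (N v), (if p.1 = r then 0 else 1 / (N p.1 : ℝ))) ≤
        8 * (c : ℝ) * (4 * energyRate c * N₀ * Fintype.card V) := by gcongr
    have h2 : 0 ≤ energyRate c * (Fintype.card V * N₀) := by positivity
    nlinarith

lemma measureReal_exists_le {ι : Type*} [Fintype ι] [IsProbabilityMeasure μ] {P : ι → Ω → Prop}
    {b : ℝ} (h : ∀ i, μ.real {ω | P i ω} ≤ b) :
    μ.real {ω | ∃ i, P i ω} ≤ Fintype.card ι * b := by
  have : {ω | ∃ i, P i ω} = ⋃ i, {ω | P i ω} := by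
    ext ω
    simp
  rw [this]
  refine (measureReal_iUnion_fintype_le _).trans ((Finset.sum_le_sum fun i _ => h i).trans ?_)
  simp

lemma card_signs (k : ℕ) :
    (Fintype.card (Fin k → Fin d × Bool) : ℝ) = (2 * d : ℝ) ^ k := by
  simp [mul_comm]

lemma measure_not_nodeRegular_le
    (h : IsSubGaussianArray c μ (fun (p : (v : V) × Fin (N v)) j ω => M p.1 ω p.2 j))
    (hc : 0 < c) (k : ℕ) (v : V) :
    μ.real {ω | ¬ NodeRegular (fun v => M v ω) (8 * c + 1) k v} ≤
      ((2 * d : ℝ) ^ (k + 1) + d) * Real.exp (-(energyRate c * N v)) := by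
  have := h.indep.isProbabilityMeasure
  have h1 := measureReal_exists_le (μ := μ) fun f : Fin (k + 1) → Fin d × Bool =>
    measure_nodeEnergy_lt_le h hc v (signedSum f)
  have h2 := measureReal_exists_le (μ := μ) fun j : Fin d =>
    measure_nodeEnergy_gt_le h hc v (Pi.single j 1)
  rw [card_signs] at h1
  rw [Fintype.card_fin] at h2
  rw [add_mul]
  refine (measureReal_mono ?_).trans ((measureReal_union_le _ _).trans (add_le_add h1 h2))
  intro ω hω
  by_contra hcon
  simp only [Set.mem_union, Set.mem_ofPred_eq, not_or, not_exists, not_lt] at hω hcon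
  refine hω ⟨hcon.1, fun j => (hcon.2 j).trans_eq ?_⟩
  simp [Pi.single_apply]

lemma measure_outerEnergy_exists_gt_le
    (h : IsSubGaussianArray c μ (fun (p : (v : V) × Fin (N v)) j ω => M p.1 ω p.2 j))
    (hc : 0 < c) (r : V) {N₀ : ℝ} (hN₀ : 0 < N₀) (hN : ∀ v, v ≠ r → N₀ ≤ N v) (k : ℕ) :
    μ.real {ω | ∃ f : Fin k → Fin d × Bool,
        (8 * c + 1) * Fintype.card V * ∑ j, signedSum f j ^ 2 <
          outerEnergy (fun v => M v ω) r (signedSum f)} ≤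
      (2 * d : ℝ) ^ k * Real.exp (-(energyRate c * (Fintype.card V * N₀))) := by
  have := h.indep.isProbabilityMeasure
  rw [← card_signs]
  exact measureReal_exists_le fun f => measure_outerEnergy_gt_le h hc r hN₀ hN _

lemma lt_measureReal_of_bad [IsProbabilityMeasure μ] {S bad : Set Ω} {ε : ℝ}
    (h : ∀ ω, ω ∉ bad → ω ∈ S) (hb : μ.real bad < ε) : 1 - ε < μ.real S := by
  have h1 : (1 : ℝ) ≤ μ.real S + μ.real bad := by
    rw [← probReal_univ (μ := μ)]
    refine (measureReal_mono fun ω _ => ?_).trans (measureReal_union_le _ _)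
    by_cases hω : ω ∈ bad
    · exact Or.inr hω
    · exact Or.inl (h ω hω)
  linarith

end Family

section Recovery

lemma card_signs_add_le_exp {d : ℕ} (hd : 2 ≤ d) (k : ℕ) :
    (2 * d : ℝ) ^ (k + 1) + d ≤ Real.exp ((2 * k + 3) * Real.log d) := by
  have hd' : (2 : ℝ) ≤ d := by exact_mod_cast hd
  have h1 : (2 * d : ℝ) ^ (k + 1) ≤ (d : ℝ) ^ (2 * k + 2) := by
    rw [show 2 * k + 2 = 2 * (k + 1) by ring, pow_mul]
    gcongr
    nlinarith
  have h2 : (d : ℝ) ≤ (d : ℝ) ^ (2 * k + 2) := le_self_pow₀ (by linarith) (by omega)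
  have h3 : Real.exp ((2 * k + 3) * Real.log d) = (d : ℝ) ^ (2 * k + 2) * d := by
    rw [← pow_succ, ← Real.rpow_natCast, Real.rpow_def_of_pos (by linarith), mul_comm]
    push_cast
    ring_nf
  have h4 : (0 : ℝ) ≤ (d : ℝ) ^ (2 * k + 2) := by positivity
  rw [h3]
  nlinarith

lemma union_bound_le {d : ℕ} (hd : 2 ≤ d) {K q : ℕ} (hq : 0 < q) {η X : ℝ} (hη : 0 < η)
    (hη1 : η ≤ 1) (hX : (2 * K + 7) * (q * (Real.log d + Real.log (1 / η))) ≤ X) :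
    ((2 * d : ℝ) ^ (K * q + 1) + d) * Real.exp (-X) ≤ η / 16 := by
  have hd' : (2 : ℝ) ≤ d := by exact_mod_cast hd
  have hq' : (1 : ℝ) ≤ q := by exact_mod_cast hq
  have hl : 0 < Real.log d := Real.log_pos (by linarith)
  have ha : 0 ≤ Real.log (1 / η) := Real.log_nonneg (by rw [le_div_iff₀ hη]; linarith)
  set a := Real.log (1 / η) with ha_def
  set ℓ := Real.log d with hl_def
  have hK : (0 : ℝ) ≤ K := by positivity
  calc ((2 * d : ℝ) ^ (K * q + 1) + d) * Real.exp (-X)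
      ≤ Real.exp ((2 * (K * q : ℕ) + 3) * ℓ) * Real.exp (-X) := by
        gcongr
        exact card_signs_add_le_exp hd _
    _ = Real.exp ((2 * (K * q) + 3) * ℓ - X) := by
        rw [← Real.exp_add]
        push_cast
        ring_nf
    _ ≤ Real.exp (-4 * ℓ + -4 * a) := by
        apply Real.exp_le_exp.2
        have h1 : (2 * (K * q) + 3) * ℓ ≤ (2 * K + 3) * q * (ℓ + a) := by
          have e1 : (2 * (K * q) + 3) * ℓ ≤ (2 * K + 3) * q * ℓ := by
            gcongr
            linarith
          have e2 : (2 * K + 3) * q * ℓ ≤ (2 * K + 3) * q * (ℓ + a) := by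
            gcongr
            linarith
          linarith
        have h2 : (2 * K + 7) * (q * (ℓ + a)) = (2 * K + 3) * q * (ℓ + a) + 4 * (q * (ℓ + a)) := by
          ring
        have h3 : ℓ + a ≤ q * (ℓ + a) := le_mul_of_one_le_left (by linarith) hq'
        linarith
    _ ≤ η / 16 := by
        have e1 : Real.exp (-4 * ℓ) ≤ 1 / 16 := by
          have : Real.exp (-4 * ℓ) = ((d : ℝ) ^ 4)⁻¹ := by
            rw [← Real.exp_log (show (0 : ℝ) < d by linarith), ← Real.exp_nat_mul, ← Real.exp_neg]
            simp [hl_def]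
          rw [this, one_div]
          refine inv_anti₀ (by norm_num) ?_
          calc (16 : ℝ) = 2 ^ 4 := by norm_num
            _ ≤ _ := by gcongr
        have e2 : Real.exp (-4 * a) ≤ η := by
          calc Real.exp (-4 * a) ≤ Real.exp (-a) := Real.exp_le_exp.2 (by linarith)
            _ = η := by rw [ha_def, one_div, Real.log_inv, neg_neg, Real.exp_log hη]
        rw [Real.exp_add]
        calc _ ≤ 1 / 16 * η := by gcongr
          _ = _ := by ring

variable {V Ω : Type*} [Fintype V] [MeasurableSpace Ω] {N : V → ℕ} {d : ℕ} {μ : Measure Ω}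
  {M : ∀ v, Ω → Matrix (Fin (N v)) (Fin d) ℝ} {c : NNReal}

/-- Exact recovery with high probability in dimension at least two. -/
lemma lt_measureReal_recovers (hc : 0 < c)
    (h : IsSubGaussianArray c μ (fun (p : (v : V) × Fin (N v)) j ω => M p.1 ω p.2 j))
    (hd : 2 ≤ d) {r : V} {x : V → Fin d → ℝ} {s t m K : ℕ} {C ε : ℝ} (hε : 0 < ε) (hε1 : ε < 1)
    (hK : 100 * (8 * c + 1) * (4 * (8 * c + 1) + 1) ≤ (K : ℝ))
    (hC : 2 * K + 7 ≤ energyRate c * C)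
    (hm : 0 < m) (hsm : s ≤ m) (htm : Fintype.card V ^ 2 * t ≤ m)
    (hs : (supp (x r)).ncard ≤ s) (hx : ∀ v, (supp (x v - x r)).ncard ≤ t)
    (hNr : C * (m * (Real.log d + Real.log (1 / ε))) ≤ N r)
    (hN : ∀ v, v ≠ r →
      C * (Fintype.card V * t * (Real.log d + Real.log (Fintype.card V / ε))) ≤ N v) :
    1 - ε < μ.real {ω | Recovers r (fun v => M v ω) x} := by
  have := h.indep.isProbabilityMeasure
  have hγ := energyRate_pos hc
  have hB : (0 : ℝ) < 8 * c + 1 := by positivity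
  have hK0 : 0 < K := by
    have : (0 : ℝ) < K := lt_of_lt_of_le (by positivity) hK
    exact_mod_cast this
  have hd' : (2 : ℝ) ≤ d := by exact_mod_cast hd
  have hl : 0 < Real.log d := Real.log_pos (by linarith)
  have ha : 0 ≤ Real.log (1 / ε) := Real.log_nonneg (by rw [le_div_iff₀ hε]; linarith)
  have hroot : μ.real {ω | ¬ NodeRegular (fun v => M v ω) (8 * c + 1) (K * m) r} ≤ ε / 16 := by
    refine (measure_not_nodeRegular_le h hc _ r).trans (union_bound_le hd hm hε hε1.le ?_)
    calc (2 * K + 7 : ℝ) * (m * (Real.log d + Real.log (1 / ε)))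
        ≤ energyRate c * C * (m * (Real.log d + Real.log (1 / ε))) := by gcongr
      _ = energyRate c * (C * (m * (Real.log d + Real.log (1 / ε)))) := by ring
      _ ≤ _ := by gcongr
  rcases Nat.eq_zero_or_pos t with rfl | ht
  · refine lt_measureReal_of_bad
      (bad := {ω | ¬ NodeRegular (fun v => M v ω) (8 * c + 1) (K * m) r}) (fun ω hω => ?_)
      (hroot.trans_lt (by linarith))
    simp only [Set.mem_ofPred_eq, not_not] at hω ⊢
    exact recovers_of_no_differences (le_trans (by nlinarith) hK) hK0 hm hsm hs
      (fun v => eq_zero_of_ncard_supp (hx v)) hω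
  set n := Fintype.card V with hn
  have hn0 : 0 < n := Fintype.card_pos_iff.2 ⟨r⟩
  have hn' : (1 : ℝ) ≤ n := by exact_mod_cast hn0
  have ht' : (1 : ℝ) ≤ t := by exact_mod_cast ht
  have hη : 0 < ε / n := by positivity
  have hη1 : ε / n ≤ 1 := (div_le_one (by linarith)).2 (by linarith)
  have hlog : Real.log (n / ε) = Real.log (1 / (ε / n)) := by rw [one_div_div]
  have han : 0 ≤ Real.log (n / ε) :=
    Real.log_nonneg (by rw [le_div_iff₀ hε]; linarith)
  have hC0 : 0 < C := by
    have : 0 < energyRate c * C := lt_of_lt_of_le (by positivity) hC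
    exact pos_of_mul_pos_right this hγ.le
  have houter : μ.real {ω | ∃ f : Fin (K * (n ^ 2 * t) + 1) → Fin d × Bool,
      (8 * c + 1) * n * ∑ j, signedSum f j ^ 2 < outerEnergy (fun v => M v ω) r (signedSum f)} ≤
      ε / 16 := by
    refine (measure_outerEnergy_exists_gt_le h hc r
      (N₀ := C * (n * t * (Real.log d + Real.log (n / ε)))) (by positivity) hN _).trans ?_
    refine le_trans ?_ ((union_bound_le hd (K := K) (q := n ^ 2 * t) (by positivity) hη hη1
      (X := energyRate c * (n * (C * (n * t * (Real.log d + Real.log (n / ε)))))) ?_).trans ?_)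
    · exact mul_le_mul_of_nonneg_right (by linarith) (Real.exp_pos _).le
    · rw [← hlog]
      push_cast
      calc (2 * K + 7 : ℝ) * (n ^ 2 * t * (Real.log d + Real.log (n / ε)))
          ≤ energyRate c * C * (n ^ 2 * t * (Real.log d + Real.log (n / ε))) := by gcongr
        _ = _ := by ring
    · have : ε / n ≤ ε := div_le_self hε.le hn'
      linarith
  have hnode : μ.real {ω | ∃ v : {v // v ≠ r},
      ¬ NodeRegular (fun v => M v ω) (8 * c + 1) (K * t) v.1} ≤ ε / 16 := by
    have hb : ∀ v : {v // v ≠ r},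
        μ.real {ω | ¬ NodeRegular (fun v => M v ω) (8 * c + 1) (K * t) v.1} ≤ ε / n / 16 := by
      intro v
      refine (measure_not_nodeRegular_le h hc _ v.1).trans (union_bound_le hd ht hη hη1 ?_)
      rw [← hlog]
      calc (2 * K + 7 : ℝ) * (t * (Real.log d + Real.log (n / ε)))
          ≤ energyRate c * C * (n * t * (Real.log d + Real.log (n / ε))) := by
            gcongr
            exact le_mul_of_one_le_left (by linarith) hn'
        _ = energyRate c * (C * (n * t * (Real.log d + Real.log (n / ε)))) := by ring
        _ ≤ _ := by
            gcongr
            exact hN v.1 v.2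
    classical
    refine (measureReal_exists_le hb).trans ?_
    have hcard : (Fintype.card {v // v ≠ r} : ℝ) ≤ n := by
      exact_mod_cast Fintype.card_subtype_le _
    calc _ ≤ n * (ε / n / 16) := by gcongr
      _ = ε / 16 := by field_simp
  refine lt_measureReal_of_bad (bad := _ ∪ (_ ∪ _)) (fun ω hω => ?_)
    (((measureReal_union_le _ _).trans
      (add_le_add hroot ((measureReal_union_le _ _).trans (add_le_add houter hnode)))).trans_lt
      (by linarith))
  simp only [Set.mem_union, Set.mem_ofPred_eq, not_or, not_exists, not_not, not_lt] at hω ⊢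
  exact recovers_of_regular hB.le hK hK0 ht hsm htm hs hx hω.1 (fun v hv => hω.2.2 ⟨v, hv⟩)
    hω.2.1

lemma eq_zero_of_rows_eq_zero {A : ∀ v, Matrix (Fin (N v)) (Fin 1) ℝ} {v : V}
    (hE : 1 / 4 * ∑ j, (Pi.single 0 1 : Fin 1 → ℝ) j ^ 2 ≤ nodeEnergy A v (Pi.single 0 1))
    {u : Fin 1 → ℝ} (hu : ∀ i, ∑ j, A v i j * u j = 0) : u = 0 := by
  by_contra hne
  have hu0 : u 0 ≠ 0 := fun h0 => hne (by ext j; rw [Subsingleton.elim j 0]; exact h0)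
  have hA : ∀ i, A v i 0 = 0 := fun i => by
    have := hu i
    rw [Fin.sum_univ_one] at this
    exact (mul_eq_zero.1 this).resolve_right hu0
  rw [nodeEnergy_eq] at hE
  simp only [Fin.sum_univ_one, hA] at hE
  norm_num at hE

/-- Exact recovery with high probability in dimension one. -/
lemma lt_measureReal_recovers_one {M : ∀ v, Ω → Matrix (Fin (N v)) (Fin 1) ℝ} (hc : 0 < c)
    (h : IsSubGaussianArray c μ (fun (p : (v : V) × Fin (N v)) j ω => M p.1 ω p.2 j))
    {r : V} {x : V → Fin 1 → ℝ} {t m : ℕ} {C ε : ℝ} (hε : 0 < ε) (hε1 : ε < 1)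
    (hC2 : 2 ≤ energyRate c * C)
    (hC : Real.exp (-((energyRate c * C - 1) * Real.log 2)) < 1 - Real.exp (-(energyRate c / 2)))
    (hm : 0 < m) (hx : ∀ v, (supp (x v - x r)).ncard ≤ t)
    (hNr : C * (m * Real.log (1 / ε)) ≤ N r)
    (hN : ∀ v, v ≠ r → C * (Fintype.card V * t * Real.log (Fintype.card V / ε)) ≤ N v) :
    1 - ε < μ.real {ω | Recovers r (fun v => M v ω) x} := by
  have := h.indep.isProbabilityMeasure
  have hγ := energyRate_pos hc
  have hm' : (1 : ℝ) ≤ m := by exact_mod_cast hm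
  have ha : 0 < Real.log (1 / ε) := Real.log_pos (by rw [lt_div_iff₀ hε]; linarith)
  have hC0 : 0 < C := pos_of_mul_pos_right (lt_of_lt_of_le two_pos hC2) hγ.le
  set γ := energyRate c
  have hroot : μ.real {ω | nodeEnergy (fun v => M v ω) r (Pi.single 0 1) <
      1 / 4 * ∑ j, (Pi.single 0 1 : Fin 1 → ℝ) j ^ 2} ≤ Real.exp (-(γ / 2)) * ε := by
    refine (measure_nodeEnergy_lt_le h hc r _).trans ?_
    have hNpos : (0 : ℝ) < N r := lt_of_lt_of_le (by positivity) hNr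
    have hN1 : (1 : ℝ) ≤ N r := by
      have : 0 < N r := by exact_mod_cast hNpos
      exact_mod_cast this
    have hεe : ε = Real.exp (-Real.log (1 / ε)) := by
      rw [one_div, Real.log_inv, neg_neg, Real.exp_log hε]
    calc Real.exp (-(γ * N r)) ≤ Real.exp (-(γ / 2) + -Real.log (1 / ε)) := by
          apply Real.exp_le_exp.2
          have e1 : γ * 1 ≤ γ * N r := by gcongr
          have e2 : 2 * Real.log (1 / ε) ≤ γ * N r := by
            calc 2 * Real.log (1 / ε) ≤ γ * C * (m * Real.log (1 / ε)) := by
                  gcongr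
                  exact le_mul_of_one_le_left ha.le hm'
              _ = γ * (C * (m * Real.log (1 / ε))) := by ring
              _ ≤ _ := by gcongr
          linarith
      _ = _ := by rw [Real.exp_add, ← hεe]
  have hexp1 : Real.exp (-(γ / 2)) < 1 := by
    have := Real.exp_pos (-((γ * C - 1) * Real.log 2))
    linarith
  rcases Nat.eq_zero_or_pos t with rfl | ht
  · refine lt_measureReal_of_bad (fun ω hω => ?_)
      (hroot.trans_lt (mul_lt_of_lt_one_left hε hexp1))
    simp only [Set.mem_ofPred_eq, not_lt] at hω ⊢
    intro z hz hobj
    have hr : z r - x r = 0 := eq_zero_of_rows_eq_zero hω (hz r)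
    refine eq_of_cone_bounds (g := 0) hobj ?_ (fun v _ => ?_) ?_
    · rw [hr]
      simp [l1On, l1Norm]
    · rw [eq_zero_of_ncard_supp (hx v), l1On_zero_left]
      have := l1Norm_nonneg (z v - x v - (z r - x r))
      simp only [Pi.zero_apply, zero_add]
      positivity
    · rw [hr]
      simp [l1Norm]
  set n := Fintype.card V with hn
  have hn0 : 0 < n := Fintype.card_pos_iff.2 ⟨r⟩
  have hn' : (0 : ℝ) < n := by exact_mod_cast hn0
  have ht' : (1 : ℝ) ≤ t := by exact_mod_cast ht
  have hnode : μ.real {ω | ∃ v : {v // v ≠ r}, nodeEnergy (fun v => M v ω) v.1 (Pi.single 0 1) <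
      1 / 4 * ∑ j, (Pi.single 0 1 : Fin 1 → ℝ) j ^ 2} ≤
      Real.exp (-((γ * C - 1) * Real.log 2)) * ε := by
    have hb : ∀ v : {v // v ≠ r}, μ.real {ω | nodeEnergy (fun v => M v ω) v.1 (Pi.single 0 1) <
        1 / 4 * ∑ j, (Pi.single 0 1 : Fin 1 → ℝ) j ^ 2} ≤
        Real.exp (-((γ * C - 1) * Real.log 2)) * (ε / n) := by
      intro v
      refine (measure_nodeEnergy_lt_le h hc v.1 _).trans ?_
      have hn2 : (2 : ℝ) ≤ n := by
        have : 1 < n := Fintype.one_lt_card_iff.2 ⟨v.1, r, v.2⟩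
        exact_mod_cast this
      have hlog2 : Real.log 2 ≤ Real.log (n / ε) := by
        apply Real.log_le_log two_pos
        rw [le_div_iff₀ hε]
        nlinarith
      have hl2 := Real.log_pos one_lt_two
      have hεe : ε / n = Real.exp (-Real.log (n / ε)) := by
        rw [← Real.log_inv, inv_div, Real.exp_log (by positivity)]
      rw [hεe, ← Real.exp_add]
      apply Real.exp_le_exp.2
      have e1 : γ * C * Real.log (n / ε) ≤ γ * N v.1 := by
        calc γ * C * Real.log (n / ε) ≤ γ * C * (n * t * Real.log (n / ε)) := by
              gcongr
              exact le_mul_of_one_le_left (by linarith) (by nlinarith)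
          _ = γ * (C * (n * t * Real.log (n / ε))) := by ring
          _ ≤ _ := by
              gcongr
              exact hN v.1 v.2
      have e2 : (γ * C - 1) * Real.log 2 ≤ (γ * C - 1) * Real.log (n / ε) :=
        mul_le_mul_of_nonneg_left hlog2 (by linarith)
      linarith
    classical
    refine (measureReal_exists_le hb).trans ?_
    have hcard : (Fintype.card {v // v ≠ r} : ℝ) ≤ n := by
      exact_mod_cast Fintype.card_subtype_le _
    calc _ ≤ n * (Real.exp (-((γ * C - 1) * Real.log 2)) * (ε / n)) := by gcongr
      _ = _ := by field_simp
  refine lt_measureReal_of_bad (bad := _ ∪ _) (fun ω hω => ?_)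
    (((measureReal_union_le _ _).trans (add_le_add hroot hnode)).trans_lt (by nlinarith))
  simp only [Set.mem_union, Set.mem_ofPred_eq, not_or, not_exists, not_lt] at hω ⊢
  intro z hz _
  ext1 v
  by_cases hv : v = r
  · subst hv
    exact sub_eq_zero.1 (eq_zero_of_rows_eq_zero hω.1 (hz v))
  · exact sub_eq_zero.1 (eq_zero_of_rows_eq_zero (hω.2 ⟨v, hv⟩) (hz v))

lemma exists_sample_constant {γ : ℝ} (hγ : 0 < γ) (a : ℝ) :
    ∃ C : ℝ, 0 < C ∧ a ≤ γ * C ∧ 2 ≤ γ * C ∧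
      Real.exp (-((γ * C - 1) * Real.log 2)) < 1 - Real.exp (-(γ / 2)) := by
  have hl2 := Real.log_pos one_lt_two
  have hpos : 0 < 1 - Real.exp (-(γ / 2)) := by
    have : Real.exp (-(γ / 2)) < 1 := by
      rw [← Real.exp_zero]
      exact Real.exp_lt_exp.2 (by linarith)
    linarith
  set y := Real.log (1 - Real.exp (-(γ / 2)))
  set G := max (max a 2) ((1 - y) / Real.log 2 + 1)
  have hG2 : 2 ≤ G := (le_max_right a 2).trans (le_max_left _ _)
  have hγG : γ * (G / γ) = G := by field_simp
  refine ⟨G / γ, by positivity, ?_, ?_, ?_⟩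
  · rw [hγG]
    exact (le_max_left a 2).trans (le_max_left _ _)
  · rw [hγG]
    exact hG2
  · rw [hγG, ← Real.lt_log_iff_exp_lt hpos]
    have h1 : (1 - y) / Real.log 2 ≤ G - 1 := by
      have := le_max_right (max a 2) ((1 - y) / Real.log 2 + 1)
      linarith
    rw [div_le_iff₀ hl2] at h1
    linarith

end Recovery

theorem theorem1 (β κ : ℝ) (hκ : 0 < κ) :
    ∃ C : ℝ, 0 < C ∧
      ∀ (V : Type*) [Fintype V] (G : SimpleGraph V) (r : V) (d s s' : ℕ)
        (x : V → Fin d → ℝ) (N : V → ℕ)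
        (Ω : Type*) [MeasurableSpace Ω] (μ : Measure Ω) [IsProbabilityMeasure μ]
        (M : ∀ v, Ω → Matrix (Fin (N v)) (Fin d) ℝ) (ε : ℝ),
        G.Connected →
        IsGraphSparse G r s s' x →
        IsSubGaussianFamily β κ μ M →
        0 < ε → ε < 1 →
        C * (max (s : ℝ) ((Fintype.card V : ℝ) ^ 2 * G.diam * s') *
          (Real.log d + Real.log (1 / ε))) ≤ N r →
        (∀ v, v ≠ r →
          C * ((Fintype.card V : ℝ) * G.diam * s' *
            (Real.log d + Real.log (Fintype.card V / ε))) ≤ N v) →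
        1 - ε < μ.real {ω | ∀ z : V → Fin d → ℝ,
          IsTVBPSolution (SimpleGraph.starGraph r) r (normalizedDesign M ω)
            (fun v => (normalizedDesign M ω v).mulVec (x v)) z ↔ z = x} := by
  have hc := subGaussianConst_pos β hκ
  set c := subGaussianConst β κ
  obtain ⟨K, hK⟩ := exists_nat_ge (100 * (8 * (c : ℝ) + 1) * (4 * (8 * c + 1) + 1))
  obtain ⟨C, hC0, hCK, hC2, hC1⟩ := exists_sample_constant (energyRate_pos hc) (2 * (K : ℝ) + 7)
  refine ⟨C, hC0, ?_⟩
  intro V _ G r d s s' x N Ω _ μ _ M ε hG hsp hfam hε hε1 hNr hN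
  have harr := hfam.isSubGaussianArray hκ
  suffices hrec : 1 - ε < μ.real {ω | Recovers r (fun v => M v ω) x} from
    hrec.trans_le (measureReal_mono fun ω hω => isTVBPSolution_iff_of_recovers hω)
  have htriv : (∀ v, x v = 0) → 1 - ε < μ.real {ω | Recovers r (fun v => M v ω) x} := fun hx0 =>
    lt_measureReal_of_bad (bad := ∅) (fun ω _ => recovers_of_forall_eq_zero r hx0) (by simpa)
  have hx := fun v => hsp.ncard_supp_sub_le hG v r
  have hmax : max (s : ℝ) ((Fintype.card V : ℝ) ^ 2 * G.diam * s') =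
      ((max s (Fintype.card V ^ 2 * (G.diam * s')) : ℕ) : ℝ) := by
    push_cast
    rw [mul_assoc]
  have hcast : (Fintype.card V : ℝ) * G.diam * s' = Fintype.card V * ((G.diam * s' : ℕ) : ℝ) := by
    push_cast
    ring
  rw [hmax] at hNr
  simp only [hcast] at hN
  set t := G.diam * s'
  have hsm : s ≤ max s (Fintype.card V ^ 2 * t) := le_max_left _ _
  have htm : Fintype.card V ^ 2 * t ≤ max s (Fintype.card V ^ 2 * t) := le_max_right _ _
  set m := max s (Fintype.card V ^ 2 * t)
  rcases Nat.eq_zero_or_pos m with hm | hm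
  · have hn0 : 0 < Fintype.card V := Fintype.card_pos_iff.2 ⟨r⟩
    have hs0 : s ≤ 0 := hsm.trans hm.le
    have ht0 : t = 0 := by
      have : Fintype.card V ^ 2 * t = 0 := Nat.le_zero.1 (htm.trans hm.le)
      exact (mul_eq_zero.1 this).resolve_left (by positivity)
    have hr : x r = 0 := eq_zero_of_ncard_supp (hsp.1.trans hs0)
    refine htriv fun v => ?_
    have := eq_zero_of_ncard_supp ((hx v).trans ht0.le)
    rwa [hr, sub_zero] at this
  rcases Nat.lt_or_ge d 2 with hd | hd
  · interval_cases d
    · exact htriv fun v => Subsingleton.elim _ _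
    · simp only [Nat.cast_one, Real.log_one, zero_add] at hNr hN
      exact lt_measureReal_recovers_one hc harr hε hε1 hC2 hC1 hm hx hNr hN
  · exact lt_measureReal_recovers hc harr hd hε hε1 hK hCK hm hsm htm hsp.1 hx hNr hN
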